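/- Let $m\ge 0$ be an integer and $\mathcal H_m=L^2(\mathbb R^m)$, with annihilation operators $a_j=(x_j+ip_j)/\sqrt2$, $p_j=-i\partial_j$, $1\le j\le m$. For $z\in\mathbb C^m$ let $\mathcal D(z)=\exp\big[\sum_j (z_j a_j^\dagger-z_j^* a_j)\big]$ be the displacement operator, i.e. $(\mathcal D(z)f)(x)=e^{i\sqrt2\,z_I\cdot x-i z_I\cdot z_R}f(x-\sqrt2\,z_R)$ with $z=z_R+iz_I$, and let $J=(-1)^{\sum_j a_j^\dagger a_j}$ be the parity operator, $(Jf)(x)=f(-x)$. For a trace class operator $T$ on $\mathcal H_m$ define its characteristic function $\chi_T(z)=\operatorname{Tr}[T\,\mathcal D(z)]$ and its Wigner function $$W_T(z)=\int_{\mathbb C^m}\frac{d^{2m}w}{\pi^{2m}}\,\chi_T(w)\,e^{\sum_j (z_j w_j^*-z_j^* w_j)}$$ (whenever $\chi_T$ is integrable). Let $U=\exp\big[\tfrac{\pi}{4}\sum_j(a_j^\dagger b_j-a_j b_j^\dagger)\big]$ be the 50:50 beam splitter on $\mathcal H_m\otimes\mathcal H_m=L^2(\mathbb R^m\times\mathbb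 R^m)$, where $a_j$ and $b_j$ are the annihilation operators of the first and second set of modes; that is, $(UF)(x,y)=F\big(\tfrac{x-y}{\sqrt2},\tfrac{x+y}{\sqrt2}\big)$. For $m$-mode quantum states $\rho,\sigma$ (positive semidefinite trace class operators on $\mathcal H_m$ with unit trace) let $\rho\boxplus\sigma=\operatorname{Tr}_2\big[U(\rho\otimes\sigma)U^\dagger\big]$, where $\operatorname{Tr}_2$ is the partial trace over the second set of modes. Then for all $m$-mode quantum states $\rho,\sigma$ the function $\chi_{\rho\boxplus\sigma}$ is integrable on $\mathbb C^m$, and for every $z\in\mathbb C^m$ $$W_{\rho\boxplus\sigma}(z)=\frac{2^m}{\pi^m}\operatorname{Tr}\Big[\rho\,\mathcal D(\sqrt2 z)\,J\sigma J\,\mathcal D(\sqrt2 z)^\dagger\Big],$$ the trace on the right being well defined. In particular, $W_{\rho\boxplus\sigma}(z)$ is real and $W_{\rho\boxplus\sigma}(z)\ge 0$ for every $z\in\mathbb C^m$. -/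

import Mathlib

open MeasureTheory

noncomputable section

namespace CV

/-! ### Trace, density operators and partial trace -/

section Abstract

variable {H K : Type} [NormedAddCommGroup H] [InnerProductSpace ℂ H] [CompleteSpace H]
  [NormedAddCommGroup K] [InnerProductSpace ℂ K] [CompleteSpace K]

/-- `T` has a well-defined trace, equal to `c`: for every orthonormal basis `b` of `H` the family
`⟨b i, T (b i)⟩` is (unconditionally, i.e. absolutely) summable, with sum `c`.  For a positive
operator this says that `T` is trace class with trace `c`. -/
def HasTrace (T : H →L[ℂ] H) (c : ℂ) : Prop :=
  ∀ (ι : Type) (b : HilbertBasis ι ℂ H), HasSum (fun i => inner ℂ (b i) (T (b i))) c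

theorem HasTrace.unique {T : H →L[ℂ] H} {c d : ℂ} (hc : HasTrace T c) (hd : HasTrace T d) :
    c = d := by
  obtain ⟨w, b, -⟩ := exists_hilbertBasis ℂ H
  exact (hc w b).unique (hd w b)

open Classical in
/-- The trace of an operator (zero if the operator has no well-defined trace). -/
def trace (T : H →L[ℂ] H) : ℂ :=
  if h : ∃ c, HasTrace T c then h.choose else 0

theorem HasTrace.trace_eq {T : H →L[ℂ] H} {c : ℂ} (h : HasTrace T c) : trace T = c := by
  have h' : ∃ c, HasTrace T c := ⟨c, h⟩
  rw [trace, dif_pos h']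
  exact h'.choose_spec.unique h

/-- Quantum states: positive semidefinite trace class operators with unit trace. -/
structure IsDensityOperator (ρ : H →L[ℂ] H) : Prop where
  isPositive : ρ.IsPositive
  hasTrace_one : HasTrace ρ 1

end Abstract

/-! ### The Hilbert spaces of `m` modes and of two sets of `m` modes -/

/-- The configuration space `ℝᵐ`. -/
abbrev Pos (m : ℕ) : Type := EuclideanSpace ℝ (Fin m)

/-- The Hilbert space `L²(ℝᵐ)` of `m` modes. -/
abbrev ModeSpace (m : ℕ) : Type := Lp ℂ 2 (volume : Measure (Pos m))

/-- The Hilbert space `L²(ℝᵐ × ℝᵐ) = L²(ℝᵐ) ⊗ L²(ℝᵐ)` of two sets of `m` modes. -/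
abbrev TwoModeSpace (m : ℕ) : Type := Lp ℂ 2 (volume : Measure (Pos m × Pos m))

variable {m : ℕ}

/-! ### Annihilation and creation operators on functions -/

/-- The annihilation operator `a_j = (x_j + i p_j) / √2`, with `p_j = -i ∂_j`. -/
def annih (j : Fin m) (f : Pos m → ℂ) (x : Pos m) : ℂ :=
  ((x j : ℂ) * f x + fderiv ℝ f x (EuclideanSpace.single j 1)) / (√2 : ℝ)

/-- The creation operator `a_j† = (x_j - i p_j) / √2`, with `p_j = -i ∂_j`. -/
def creat (j : Fin m) (f : Pos m → ℂ) (x : Pos m) : ℂ :=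
  ((x j : ℂ) * f x - fderiv ℝ f x (EuclideanSpace.single j 1)) / (√2 : ℝ)

theorem clm_eq_sum_single (L : Pos m →L[ℝ] ℂ) (v : Pos m) :
    L v = ∑ j, (v j : ℂ) * L (EuclideanSpace.single j 1) := by
  have h := (EuclideanSpace.basisFun (Fin m) ℝ).sum_repr v
  conv_lhs => rw [← h]
  simp [map_sum, Complex.real_smul]

/-! ### Displacement operators -/

/-- The real part of a complex vector. -/
def rePart (z : Fin m → ℂ) : Pos m := WithLp.toLp 2 fun j => (z j).re

/-- The imaginary part of a complex vector. -/
def imPart (z : Fin m → ℂ) : Pos m := WithLp.toLp 2 fun j => (z j).im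

/-- The phase `exp (i √2 z_I·x - i z_I·z_R)`. -/
def dispPhase (z : Fin m → ℂ) (x : Pos m) : ℂ :=
  Complex.exp (Complex.I *
    ((√2 * inner ℝ (imPart z) x - inner ℝ (imPart z) (rePart z) : ℝ) : ℂ))

/-- The action of `D(z) = exp (∑ⱼ (z_j a_j† - z_j* a_j))` on wave functions:
`(D(z) f)(x) = exp (i √2 z_I·x - i z_I·z_R) f(x - √2 z_R)`. -/
def dispFun (z : Fin m → ℂ) (f : Pos m → ℂ) (x : Pos m) : ℂ :=
  dispPhase z x * f (x - √2 • rePart z)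

theorem norm_dispPhase (z : Fin m → ℂ) (x : Pos m) : ‖dispPhase z x‖ = 1 := by
  rw [dispPhase, mul_comm]; exact Complex.norm_exp_ofReal_mul_I _

theorem continuous_dispPhase (z : Fin m → ℂ) : Continuous (dispPhase z) := by
  unfold dispPhase; fun_prop

theorem measurePreserving_shift (z : Fin m → ℂ) :
    MeasurePreserving (fun x : Pos m => x - √2 • rePart z) volume volume :=
  measurePreserving_sub_right volume _

theorem memLp_dispFun (z : Fin m → ℂ) (f : ModeSpace m) : MemLp (dispFun z f) 2 volume := by
  have h1 : MemLp (fun x => f (x - √2 • rePart z)) 2 (volume : Measure (Pos m)) :=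
    (Lp.memLp f).comp_measurePreserving (measurePreserving_shift z)
  refine h1.of_le ((continuous_dispPhase z).aestronglyMeasurable.mul h1.1) ?_
  filter_upwards with x
  simp [dispFun, norm_dispPhase]

/-- The displacement operator `D(z)` on `L²(ℝᵐ)`. -/
def displacement (z : Fin m → ℂ) : ModeSpace m →L[ℂ] ModeSpace m :=
  LinearMap.mkContinuous
    { toFun := fun f => (memLp_dispFun z f).toLp _
      map_add' := by
        intro f g
        rw [← MemLp.toLp_add]
        refine MemLp.toLp_congr _ _ ?_
        filter_upwards [(measurePreserving_shift z).quasiMeasurePreserving.ae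
          (Lp.coeFn_add f g)] with x hx
        simp only [dispFun, Pi.add_apply] at hx ⊢
        rw [hx]; ring
      map_smul' := by
        intro c f
        rw [RingHom.id_apply, ← MemLp.toLp_const_smul]
        refine MemLp.toLp_congr _ _ ?_
        filter_upwards [(measurePreserving_shift z).quasiMeasurePreserving.ae
          (Lp.coeFn_smul c f)] with x hx
        simp only [dispFun, Pi.smul_apply, smul_eq_mul] at hx ⊢
        rw [hx]; ring }
    1 (by
      intro f
      rw [one_mul]
      simp only [LinearMap.coe_mk, AddHom.coe_mk, Lp.norm_toLp]
      rw [Lp.norm_def]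
      refine ENNReal.toReal_mono (Lp.eLpNorm_ne_top f) (le_of_eq ?_)
      rw [← eLpNorm_comp_measurePreserving (Lp.aestronglyMeasurable f)
        (measurePreserving_shift z)]
      refine eLpNorm_congr_norm_ae ?_
      filter_upwards with x
      simp [dispFun, norm_dispPhase])

theorem displacement_coeFn (z : Fin m → ℂ) (f : ModeSpace m) :
    displacement z f =ᵐ[volume] dispFun z f :=
  (memLp_dispFun z f).coeFn_toLp

theorem dispFun_zero (f : Pos m → ℂ) : dispFun 0 f = f := by
  have h : rePart (0 : Fin m → ℂ) = 0 := by ext j; simp [rePart]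
  have h' : imPart (0 : Fin m → ℂ) = 0 := by ext j; simp [imPart]
  funext x
  simp [dispFun, dispPhase, h, h']

theorem sum_creat_sub_annih (z : Fin m → ℂ) (g : Pos m → ℂ) (x : Pos m) :
    ∑ j, (z j * creat j g x - starRingEnd ℂ (z j) * annih j g x)
      = Complex.I * ((√2 * inner ℝ (imPart z) x : ℝ) : ℂ) * g x
        - (√2 : ℝ) * fderiv ℝ g x (rePart z) := by
  have h2 : ((√2 : ℝ) : ℂ) ≠ 0 := by
    exact_mod_cast (Real.sqrt_pos.mpr (by norm_num : (0 : ℝ) < 2)).ne'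
  have h3 : ((√2 : ℝ) : ℂ) * ((√2 : ℝ) : ℂ) = 2 := by
    rw [← Complex.ofReal_mul, Real.mul_self_sqrt (by norm_num)]; norm_num
  rw [clm_eq_sum_single (fderiv ℝ g x) (rePart z)]
  simp only [PiLp.inner_apply, Complex.ofReal_mul, Complex.ofReal_sum, Finset.mul_sum,
    Finset.sum_mul]
  rw [← Finset.sum_sub_distrib]
  refine Finset.sum_congr rfl fun j _ => ?_
  have hz : z j = ((z j).re : ℂ) + ((z j).im : ℂ) * Complex.I := (Complex.re_add_im _).symm
  have hc : starRingEnd ℂ (z j) = ((z j).re : ℂ) - ((z j).im : ℂ) * Complex.I := by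
    apply Complex.ext <;> simp
  have hi : (inner ℝ (imPart z j) (x j) : ℝ) = (z j).im * x j := by
    simp [imPart, mul_comm]
  have hr : rePart z j = (z j).re := rfl
  rw [hi, hr, hc]
  generalize (z j).re = r at *
  generalize (z j).im = i at *
  rw [hz]
  simp only [creat, annih, Complex.ofReal_mul]
  field_simp
  linear_combination (r * (fderiv ℝ g x) (EuclideanSpace.single j 1)
    - i * x j * g x * Complex.I) * h3

theorem rePart_smul (t : ℝ) (z : Fin m → ℂ) : rePart (t • z) = t • rePart z := by
  ext j; simp [rePart]

theorem imPart_smul (t : ℝ) (z : Fin m → ℂ) : imPart (t • z) = t • imPart z := by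
  ext j; simp [imPart]

/-- `t ↦ D(t z)` solves the evolution equation generated by `∑ⱼ (z_j a_j† - z_j* a_j)`. -/
theorem hasDerivAt_dispFun (z : Fin m → ℂ) {f : Pos m → ℂ} (hf : Differentiable ℝ f)
    (x : Pos m) (t : ℝ) :
    HasDerivAt (fun s : ℝ => dispFun (s • z) f x)
      (∑ j, (z j * creat j (dispFun (t • z) f) x
        - starRingEnd ℂ (z j) * annih j (dispFun (t • z) f) x)) t := by
  rw [sum_creat_sub_annih]
  set a : ℝ := inner ℝ (imPart z) (rePart z) with ha
  set y : Pos m := x - √2 • t • rePart z with hy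
  -- the derivative in `t`
  have hP : HasDerivAt (fun s : ℝ => dispPhase (s • z) x)
      (dispPhase (t • z) x *
        (Complex.I * ((√2 * inner ℝ (imPart z) x - 2 * t * a : ℝ) : ℂ))) t := by
    have h0 : HasDerivAt (fun s : ℝ => √2 * (s * inner ℝ (imPart z) x) - s * (s * a))
        (√2 * inner ℝ (imPart z) x - 2 * t * a) t := by
      have h1 := ((hasDerivAt_id t).mul_const (inner ℝ (imPart z) x)).const_mul √2
      have h2 := (hasDerivAt_id t).mul ((hasDerivAt_id t).mul_const a)
      refine (h1.sub h2).congr_deriv ?_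
      simp only [id]; ring
    have h3 := ((h0.ofReal_comp).const_mul Complex.I).cexp
    simpa only [dispPhase, rePart_smul, imPart_smul, inner_smul_left, inner_smul_right,
      conj_trivial] using h3
  have hG : HasDerivAt (fun s : ℝ => f (x - √2 • rePart (s • z)))
      (-(√2 : ℝ) * fderiv ℝ f y (rePart z)) t := by
    have h1 : HasDerivAt (fun s : ℝ => x - √2 • rePart (s • z)) (-(√2 • rePart z)) t := by
      simp only [rePart_smul]
      have h := (((hasDerivAt_id t).smul_const (rePart z)).const_smul √2).const_sub x
      simpa using h
    have h2 := (hf (x - √2 • rePart (t • z))).hasFDerivAt.comp_hasDerivAt t h1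
    refine h2.congr_deriv ?_
    rw [rePart_smul, ← hy, map_neg, map_smul, Complex.real_smul, neg_mul]
  -- the derivative in `x`
  have hPx : HasFDerivAt (fun x => dispPhase (t • z) x)
      ((dispPhase (t • z) x) • (Complex.I • (Complex.ofRealCLM.comp
        (√2 • (t • innerSL ℝ (imPart z)))))) x := by
    have h0 : HasFDerivAt (fun x : Pos m => √2 * (t * inner ℝ (imPart z) x) - t * (t * a))
        (√2 • (t • innerSL ℝ (imPart z))) x :=
      ((((innerSL ℝ (imPart z)).hasFDerivAt.const_mul t)).const_mul √2).sub_const _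
    have h3 := ((Complex.ofRealCLM.hasFDerivAt.comp x h0).const_mul Complex.I).cexp
    simpa only [dispPhase, rePart_smul, imPart_smul, inner_smul_left, inner_smul_right,
      conj_trivial, Function.comp_def, Complex.ofRealCLM_apply, ← ha] using h3
  have hGx : HasFDerivAt (fun x : Pos m => f (x - √2 • rePart (t • z))) (fderiv ℝ f y) x := by
    have h2 := (hf (x - √2 • rePart (t • z))).hasFDerivAt.comp x
      ((hasFDerivAt_id x).sub_const (√2 • rePart (t • z)))
    rw [rePart_smul] at h2 ⊢
    simpa [Function.comp_def] using h2
  have hx := (hPx.mul hGx).fderiv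
  have hx' : fderiv ℝ (dispFun (t • z) f) x (rePart z)
      = dispPhase (t • z) x * fderiv ℝ f y (rePart z)
        + f y * (dispPhase (t • z) x * (Complex.I * ((√2 * (t * a) : ℝ) : ℂ))) := by
    have : dispFun (t • z) f = dispPhase (t • z) * (fun x : Pos m => f (x - √2 • rePart (t • z))) :=
      rfl
    rw [this, hx, rePart_smul]
    simp [hy, ha]
  rw [hx']
  refine (hP.mul hG).congr_deriv ?_
  have h3 : ((√2 : ℝ) : ℂ) * ((√2 : ℝ) : ℂ) = 2 := by
    rw [← Complex.ofReal_mul, Real.mul_self_sqrt (by norm_num)]; norm_num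
  simp only [dispFun, rePart_smul, ← hy]
  push_cast
  linear_combination (f y * dispPhase (t • z) x * Complex.I * t * a) * h3

/-! ### The parity operator -/

/-- The parity operator `J = (-1)^(∑ⱼ a_j† a_j)`, `(J f)(x) = f(-x)`, on `L²(ℝᵐ)`. -/
def parity (m : ℕ) : ModeSpace m →L[ℂ] ModeSpace m :=
  (Lp.compMeasurePreservingₗᵢ ℂ (fun x : Pos m => -x)
    (Measure.measurePreserving_neg volume)).toContinuousLinearMap

theorem parity_coeFn (f : ModeSpace m) : parity m f =ᵐ[volume] fun x => f (-x) :=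
  Lp.coeFn_compMeasurePreserving f (Measure.measurePreserving_neg volume)

theorem parity_parity (f : ModeSpace m) : parity m (parity m f) = f := by
  refine Lp.ext ?_
  filter_upwards [parity_coeFn (parity m f),
    (Measure.measurePreserving_neg (volume : Measure (Pos m))).quasiMeasurePreserving.ae
      (parity_coeFn f)] with x h1 h2
  rw [h1, h2, neg_neg]

theorem adjoint_parity : ContinuousLinearMap.adjoint (parity m) = parity m := by
  refine (ContinuousLinearMap.eq_adjoint_iff _ _).2 (fun f g => ?_) |>.symm
  have h := (Lp.compMeasurePreservingₗᵢ ℂ (fun x : Pos m => -x)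
    (Measure.measurePreserving_neg volume)).inner_map_map f (parity m g)
  have h' : inner ℂ (parity m f) (parity m (parity m g)) = inner ℂ f (parity m g) := h
  rwa [parity_parity] at h'

/-- `J D(z) J = D(-z)`: the parity operator inverts phase space. -/
theorem parity_displacement_parity (z : Fin m → ℂ) (f : ModeSpace m) :
    parity m (displacement z (parity m f)) = displacement (-z) f := by
  have hr : rePart (-z) = -rePart z := by ext j; simp [rePart]
  have hi : imPart (-z) = -imPart z := by ext j; simp [imPart]
  refine Lp.ext ?_
  filter_upwards [parity_coeFn (displacement z (parity m f)), displacement_coeFn (-z) f,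
    (Measure.measurePreserving_neg (volume : Measure (Pos m))).quasiMeasurePreserving.ae
      (displacement_coeFn z (parity m f)),
    ((measurePreserving_shift z).comp
      (Measure.measurePreserving_neg (volume : Measure (Pos m)))).quasiMeasurePreserving.ae
      (parity_coeFn f)] with x h1 h2 h3 h4
  simp only [Function.comp_apply] at h4
  rw [h1, h2, h3, dispFun, dispFun, h4, hr]
  congr 1
  · simp [dispPhase, hr, hi]
  · congr 1; simp [add_comm]

/-- The (unnormalised) vacuum wave function. -/
def vacuum (x : Pos m) : ℂ := (Real.exp (-‖x‖ ^ 2 / 2) : ℝ)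

theorem annih_vacuum (j : Fin m) : annih j (vacuum (m := m)) = 0 := by
  funext x
  have h0 : HasFDerivAt (fun x : Pos m => -‖x‖ ^ 2 / 2) (-innerSL ℝ x) x := by
    have h := ((hasStrictFDerivAt_norm_sq x).hasFDerivAt.neg).mul_const (2⁻¹ : ℝ)
    refine (h.congr_fderiv ?_).congr_of_eventuallyEq (.of_forall fun y => ?_)
    · ext v; simp
    · simp [div_eq_mul_inv]
  have h1 := (Complex.ofRealCLM.hasFDerivAt.comp x h0.exp).fderiv
  have h2 : fderiv ℝ (vacuum (m := m)) x (EuclideanSpace.single j 1) = -(x j : ℂ) * vacuum x := by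
    have : (vacuum (m := m)) = Complex.ofRealCLM ∘ fun x : Pos m => Real.exp (-‖x‖ ^ 2 / 2) := rfl
    rw [this, h1]
    simp [mul_comm, EuclideanSpace.inner_single_right]
  simp [annih, h2]

theorem creat_comp_neg (j : Fin m) (f : Pos m → ℂ) (c : ℂ) (hf : ∀ x, f (-x) = c * f x)
    (x : Pos m) : creat j f (-x) = -c * creat j f x := by
  have h1 : fderiv ℝ f (-x) = -(c • fderiv ℝ f x) := by
    have h2 : (fun x => f (-x)) = c • f := funext hf
    have h3 : fderiv ℝ (fun x => f (-x)) x = -fderiv ℝ f (-x) := by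
      have := (ContinuousLinearEquiv.neg ℝ (M := Pos m)).comp_right_fderiv (f := f) (x := x)
      ext v
      simpa [Function.comp_def] using DFunLike.congr_fun this v
    rw [h2, fderiv_const_smul_field] at h3
    rw [← neg_neg (fderiv ℝ f (-x)), ← h3]
    rfl
  simp only [creat, hf, h1, PiLp.neg_apply, Complex.ofReal_neg, neg_apply,
    smul_apply, smul_eq_mul]
  ring

/-- The Fock wave function with `n` photons in total is an eigenfunction of `f ↦ f(-·)` with
eigenvalue `(-1)ⁿ`. -/
theorem parity_fock (l : List (Fin m)) (x : Pos m) :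
    l.foldr creat vacuum (-x) = (-1) ^ l.length * l.foldr creat vacuum x := by
  induction l generalizing x with
  | nil => simp [vacuum]
  | cons j l ih =>
    rw [List.foldr_cons, creat_comp_neg j _ _ ih, List.length_cons, pow_succ]
    ring

/-! ### Beam splitters -/

/-- The rotation `(x, y) ↦ (cos θ x - sin θ y, sin θ x + cos θ y)` of `ℝᵐ × ℝᵐ`. -/
def rotate (θ : ℝ) (p : Pos m × Pos m) : Pos m × Pos m :=
  (Real.cos θ • p.1 - Real.sin θ • p.2, Real.sin θ • p.1 + Real.cos θ • p.2)

theorem measurePreserving_rotate (θ : ℝ) :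
    MeasurePreserving (rotate θ : Pos m × Pos m → Pos m × Pos m) volume volume := by
  let L : WithLp 2 (Pos m × Pos m) →ₗᵢ[ℝ] WithLp 2 (Pos m × Pos m) :=
    { toFun := fun p => WithLp.toLp 2 (rotate θ p.ofLp)
      map_add' := by
        intro p q
        rw [← WithLp.toLp_add]
        congr 1
        ext <;> simp [rotate] <;> ring
      map_smul' := by
        intro c p
        rw [RingHom.id_apply, ← WithLp.toLp_smul]
        congr 1
        ext <;> simp [rotate] <;> ring
      norm_map' := by
        intro p
        have h : ∀ q : WithLp 2 (Pos m × Pos m), 0 ≤ ‖q‖ := fun q => norm_nonneg q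
        rw [← sq_eq_sq₀ (norm_nonneg _) (norm_nonneg _), WithLp.prod_norm_sq_eq_of_L2,
          WithLp.prod_norm_sq_eq_of_L2]
        simp only [LinearMap.coe_mk, AddHom.coe_mk, rotate, WithLp.toLp_fst, WithLp.toLp_snd]
        rw [norm_sub_sq_real, norm_add_sq_real]
        simp only [norm_smul, inner_smul_left, inner_smul_right, mul_pow, Real.norm_eq_abs,
          sq_abs, conj_trivial, WithLp.ofLp_fst, WithLp.ofLp_snd]
        linear_combination (‖p.fst‖ ^ 2 + ‖p.snd‖ ^ 2) * Real.cos_sq_add_sin_sq θ }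
  have h := (WithLp.volume_preserving_ofLp (Pos m) (Pos m)).comp
    ((L.toLinearIsometryEquiv rfl).measurePreserving.comp
      (WithLp.volume_preserving_toLp (Pos m) (Pos m)))
  exact h

/-- The unitary `exp (θ ∑ⱼ (a_j† b_j - a_j b_j†))` on `L²(ℝᵐ × ℝᵐ)`, that is, composition with the
rotation by `θ`. -/
def modeRotation (m : ℕ) (θ : ℝ) : TwoModeSpace m →L[ℂ] TwoModeSpace m :=
  (Lp.compMeasurePreservingₗᵢ ℂ (rotate θ) (measurePreserving_rotate θ)).toContinuousLinearMap

/-- The beam splitter of transmissivity `t`, with `0 ≤ t ≤ 1`. -/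
def beamSplitter (m : ℕ) (t : ℝ) : TwoModeSpace m →L[ℂ] TwoModeSpace m :=
  modeRotation m (Real.arccos √t)

/-- An operator on functions on `ℝᵐ` applied in the first set of modes. -/
def onFst (A : (Pos m → ℂ) → Pos m → ℂ) (F : Pos m × Pos m → ℂ) (p : Pos m × Pos m) : ℂ :=
  A (fun x => F (x, p.2)) p.1

/-- An operator on functions on `ℝᵐ` applied in the second set of modes. -/
def onSnd (A : (Pos m → ℂ) → Pos m → ℂ) (F : Pos m × Pos m → ℂ) (p : Pos m × Pos m) : ℂ :=
  A (fun y => F (p.1, y)) p.2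

theorem rotate_zero (p : Pos m × Pos m) : rotate 0 p = p := by simp [rotate]

theorem sum_beamSplitter_generator {G : Pos m × Pos m → ℂ} (hG : ContDiff ℝ 2 G)
    (p : Pos m × Pos m) :
    ∑ j, (onFst (creat j) (onSnd (annih j) G) p - onFst (annih j) (onSnd (creat j) G) p)
      = fderiv ℝ G p (-p.2, p.1) := by
  have h2 : ((√2 : ℝ) : ℂ) ≠ 0 := by
    exact_mod_cast (Real.sqrt_pos.mpr (by norm_num : (0 : ℝ) < 2)).ne'
  have h3 : ((√2 : ℝ) : ℂ) * ((√2 : ℝ) : ℂ) = 2 := by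
    rw [← Complex.ofReal_mul, Real.mul_self_sqrt (by norm_num)]; norm_num
  have hd : Differentiable ℝ G := hG.differentiable (by norm_num)
  have hd' : Differentiable ℝ (fderiv ℝ G) :=
    (hG.fderiv_right (m := 1) (by norm_num)).differentiable (by norm_num)
  have hfst : ∀ (q : Pos m × Pos m) (v : Pos m),
      fderiv ℝ (fun x => G (x, q.2)) q.1 v = fderiv ℝ G q (v, 0) := by
    intro q v
    have h := ((hd q).hasFDerivAt.comp (f := fun x => (x, q.2)) q.1
      (hasFDerivAt_prodMk_left (𝕜 := ℝ) q.1 q.2)).fderiv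
    have h' : fderiv ℝ (fun x => G (x, q.2)) q.1 = _ := h
    rw [h']; rfl
  have hsnd : ∀ (q : Pos m × Pos m) (v : Pos m),
      fderiv ℝ (fun y => G (q.1, y)) q.2 v = fderiv ℝ G q (0, v) := by
    intro q v
    have h := ((hd q).hasFDerivAt.comp (f := fun y => (q.1, y)) q.2
      (hasFDerivAt_prodMk_right (𝕜 := ℝ) q.1 q.2)).fderiv
    have h' : fderiv ℝ (fun y => G (q.1, y)) q.2 = _ := h
    rw [h']; rfl
  have hL : fderiv ℝ G p (-p.2, p.1)
      = ∑ j, ((p.1 j : ℂ) * fderiv ℝ G p (0, EuclideanSpace.single j 1)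
        - (p.2 j : ℂ) * fderiv ℝ G p (EuclideanSpace.single j 1, 0)) := by
    have e : ((-p.2, p.1) : Pos m × Pos m) = (0, p.1) - (p.2, 0) := by ext <;> simp
    have e1 := clm_eq_sum_single ((fderiv ℝ G p).comp (ContinuousLinearMap.inl ℝ _ _)) p.2
    have e2 := clm_eq_sum_single ((fderiv ℝ G p).comp (ContinuousLinearMap.inr ℝ _ _)) p.1
    simp only [ContinuousLinearMap.comp_apply, ContinuousLinearMap.inl_apply,
      ContinuousLinearMap.inr_apply] at e1 e2
    rw [e, map_sub, e1, e2, Finset.sum_sub_distrib]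
  rw [hL]
  refine Finset.sum_congr rfl fun j _ => ?_
  set e : Pos m := EuclideanSpace.single j 1 with he
  have hA : ∀ ε : ℂ, fderiv ℝ (fun x : Pos m =>
      ((p.2 j : ℂ) * G (x, p.2) + ε * fderiv ℝ G (x, p.2) (0, e)) / (√2 : ℝ)) p.1 e
      = ((p.2 j : ℂ) * fderiv ℝ G p (e, 0)
        + ε * fderiv ℝ (fun x : Pos m => fderiv ℝ G (x, p.2) (0, e)) p.1 e) / (√2 : ℝ) := by
    intro ε
    have d1 : DifferentiableAt ℝ (fun x : Pos m => G (x, p.2)) p.1 := by fun_prop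
    have d2 : DifferentiableAt ℝ (fun x : Pos m => fderiv ℝ G (x, p.2) (0, e)) p.1 := by fun_prop
    have h := (((d1.hasFDerivAt.const_mul (p.2 j : ℂ)).add
      (d2.hasFDerivAt.const_mul ε)).mul_const (((√2 : ℝ) : ℂ)⁻¹)).fderiv
    simp only [div_eq_mul_inv]
    have h' : fderiv ℝ (fun x : Pos m =>
      ((p.2 j : ℂ) * G (x, p.2) + ε * fderiv ℝ G (x, p.2) (0, e)) * (((√2 : ℝ) : ℂ)⁻¹)) p.1
        = _ := h
    rw [h']
    simp [hfst p]
    ring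
  have hA1 := hA 1
  have hA2 := hA (-1)
  simp only [one_mul, neg_one_mul, ← sub_eq_add_neg] at hA1 hA2
  have hs : ∀ x : Pos m, fderiv ℝ (fun y => G (x, y)) p.2 e = fderiv ℝ G (x, p.2) (0, e) :=
    fun x => hsnd (x, p.2) e
  simp only [onFst, onSnd, creat, annih, ← he, hs, hA1, hA2]
  field_simp
  linear_combination (-((p.1 j : ℂ) * fderiv ℝ G p (0, e))
    + (p.2 j : ℂ) * fderiv ℝ G p (e, 0)) * h3

/-- Composition with `rotate θ` solves the evolution equation generated by
`∑ⱼ (a_j† b_j - a_j b_j†)`. -/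
theorem hasDerivAt_rotate {F : Pos m × Pos m → ℂ} (hF : ContDiff ℝ 2 F)
    (p : Pos m × Pos m) (θ : ℝ) :
    HasDerivAt (fun s : ℝ => F (rotate s p))
      (∑ j, (onFst (creat j) (onSnd (annih j) (F ∘ rotate θ)) p
        - onFst (annih j) (onSnd (creat j) (F ∘ rotate θ)) p)) θ := by
  have hR : ContDiff ℝ 2 (rotate θ : Pos m × Pos m → Pos m × Pos m) := by
    unfold rotate; fun_prop
  have hd : Differentiable ℝ F := hF.differentiable (by norm_num)
  rw [sum_beamSplitter_generator (hF.comp hR)]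
  let L : Pos m × Pos m →L[ℝ] Pos m × Pos m := ContinuousLinearMap.prod
    (Real.cos θ • ContinuousLinearMap.fst ℝ (Pos m) (Pos m)
      - Real.sin θ • ContinuousLinearMap.snd ℝ (Pos m) (Pos m))
    (Real.sin θ • ContinuousLinearMap.fst ℝ (Pos m) (Pos m)
      + Real.cos θ • ContinuousLinearMap.snd ℝ (Pos m) (Pos m))
  have hRd : HasFDerivAt (rotate θ : Pos m × Pos m → Pos m × Pos m) L p := L.hasFDerivAt
  have hRt : HasDerivAt (fun s : ℝ => rotate s p)
      ((-Real.sin θ) • p.1 - Real.cos θ • p.2, Real.cos θ • p.1 + (-Real.sin θ) • p.2) θ :=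
    (((Real.hasDerivAt_cos θ).smul_const p.1).sub ((Real.hasDerivAt_sin θ).smul_const p.2)).prodMk
      (((Real.hasDerivAt_sin θ).smul_const p.1).add ((Real.hasDerivAt_cos θ).smul_const p.2))
  rw [((hd _).hasFDerivAt.comp p hRd).fderiv]
  refine ((hd _).hasFDerivAt.comp_hasDerivAt θ hRt).congr_deriv ?_
  rw [ContinuousLinearMap.comp_apply]
  congr 1
  ext <;> simp [L] <;> ring

/-! ### Tensor products -/

theorem memLp_tensor (f g : ModeSpace m) :
    MemLp (fun p : Pos m × Pos m => f p.1 * g p.2) 2 volume := by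
  have hm : AEStronglyMeasurable (fun p : Pos m × Pos m => f p.1 * g p.2) volume :=
    (Lp.aestronglyMeasurable f).comp_fst.mul (Lp.aestronglyMeasurable g).comp_snd
  rw [memLp_two_iff_integrable_sq_norm hm]
  have hf := (memLp_two_iff_integrable_sq_norm (Lp.aestronglyMeasurable f)).1 (Lp.memLp f)
  have hg := (memLp_two_iff_integrable_sq_norm (Lp.aestronglyMeasurable g)).1 (Lp.memLp g)
  refine (hf.mul_prod hg).congr (.of_forall fun p => ?_)
  simp [mul_pow]

/-- The product vector `f ⊗ g`, `(f ⊗ g)(x, y) = f(x) g(y)`. -/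
def tensorVec (f g : ModeSpace m) : TwoModeSpace m := (memLp_tensor f g).toLp _

theorem tensorVec_coeFn (f g : ModeSpace m) :
    tensorVec f g =ᵐ[volume] fun p : Pos m × Pos m => f p.1 * g p.2 :=
  (memLp_tensor f g).coeFn_toLp

theorem inner_tensorVec (f g f' g' : ModeSpace m) :
    inner ℂ (tensorVec f g) (tensorVec f' g') = inner ℂ f f' * inner ℂ g g' := by
  simp only [L2.inner_def]
  rw [← integral_prod_mul (μ := (volume : Measure (Pos m))) (ν := (volume : Measure (Pos m)))]
  refine integral_congr_ae ?_
  filter_upwards [tensorVec_coeFn f g, tensorVec_coeFn f' g'] with p hp hp'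
  simp only [RCLike.inner_apply]
  rw [hp, hp', map_mul]
  ring

/-- Product vectors are total in `L²(ℝᵐ × ℝᵐ)`. -/
theorem tensorVec_total (Ψ : TwoModeSpace m)
    (h : ∀ f g : ModeSpace m, inner ℂ (tensorVec f g) Ψ = 0) : Ψ = 0 := by
  -- the integral of `Ψ` over bounded rectangles vanishes
  have hrect : ∀ A B : Set (Pos m), MeasurableSet A → MeasurableSet B → volume A ≠ ⊤ →
      volume B ≠ ⊤ → ∫ p in A ×ˢ B, Ψ p = 0 := by
    intro A B hA hB hA' hB'
    have hf := h (indicatorConstLp 2 hA hA' 1) (indicatorConstLp 2 hB hB' 1)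
    rw [L2.inner_def] at hf
    rw [← hf, ← integral_indicator (hA.prod hB)]
    refine integral_congr_ae ?_
    filter_upwards [tensorVec_coeFn (indicatorConstLp 2 hA hA' (1 : ℂ))
        (indicatorConstLp 2 hB hB' 1),
      Measure.quasiMeasurePreserving_fst.ae (indicatorConstLp_coeFn (hs := hA) (hμs := hA')
        (p := 2) (c := (1 : ℂ))),
      Measure.quasiMeasurePreserving_snd.ae (indicatorConstLp_coeFn (hs := hB) (hμs := hB')
        (p := 2) (c := (1 : ℂ)))] with p h1 h2 h3
    rw [h1, RCLike.inner_apply, h2, h3]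
    by_cases hpA : p.1 ∈ A <;> by_cases hpB : p.2 ∈ B <;> simp [hpA, hpB, Set.indicator]
  -- hence `Ψ` vanishes on each bounded rectangle
  have hball : ∀ n : ℕ, ∀ᵐ p ∂((volume : Measure (Pos m × Pos m)).restrict
      (Metric.ball (0 : Pos m) n ×ˢ Metric.ball (0 : Pos m) n)), Ψ p = 0 := by
    intro n
    set Q : Set (Pos m) := Metric.ball (0 : Pos m) n with hQ
    have hQm : MeasurableSet Q := measurableSet_ball
    have hQf : volume Q ≠ ⊤ := measure_ball_lt_top.ne
    have hQQ : (volume : Measure (Pos m × Pos m)) (Q ×ˢ Q) ≠ ⊤ := by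
      rw [Measure.volume_eq_prod, Measure.prod_prod]
      exact ENNReal.mul_ne_top hQf hQf
    have : IsFiniteMeasure ((volume : Measure (Pos m × Pos m)).restrict (Q ×ˢ Q)) :=
      isFiniteMeasure_restrict.2 hQQ
    have hint : Integrable Ψ ((volume : Measure (Pos m × Pos m)).restrict (Q ×ˢ Q)) :=
      ((Lp.memLp Ψ).restrict (Q ×ˢ Q)).integrable (by norm_num)
    refine hint.ae_eq_zero_of_forall_setIntegral_eq_zero fun s hs _ => ?_
    have hr : ∀ A B : Set (Pos m), MeasurableSet A → MeasurableSet B →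
        ∫ p in A ×ˢ B, Ψ p ∂((volume : Measure (Pos m × Pos m)).restrict (Q ×ˢ Q)) = 0 := by
      intro A B hA hB
      rw [Measure.restrict_restrict (hA.prod hB), Set.prod_inter_prod]
      exact hrect _ _ (hA.inter hQm) (hB.inter hQm)
        (measure_ne_top_of_subset Set.inter_subset_right hQf)
        (measure_ne_top_of_subset Set.inter_subset_right hQf)
    have huniv : ∫ p, Ψ p ∂((volume : Measure (Pos m × Pos m)).restrict (Q ×ˢ Q)) = 0 := by
      have := hr Set.univ Set.univ .univ .univ
      rwa [Set.univ_prod_univ, Measure.restrict_univ] at this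
    induction s, hs using MeasurableSpace.induction_on_inter generateFrom_prod.symm
      isPiSystem_prod with
    | empty => simp
    | basic t ht =>
      obtain ⟨A, hA, B, hB, rfl⟩ := ht
      exact hr A B hA hB
    | compl t htm ih =>
      have := integral_add_compl htm hint
      rw [ih (measure_lt_top _ _), huniv, zero_add] at this
      exact this
    | iUnion f hd hfm ih =>
      rw [integral_iUnion hfm hd hint.integrableOn]
      simp [ih _ (measure_lt_top _ _)]
  have hU : (⋃ n : ℕ, Metric.ball (0 : Pos m) n ×ˢ Metric.ball (0 : Pos m) n) = Set.univ := by
    refine Set.eq_univ_of_forall fun p => Set.mem_iUnion.2 ?_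
    obtain ⟨n, hn⟩ := exists_nat_gt (max ‖p.1‖ ‖p.2‖)
    refine ⟨n, ?_, ?_⟩
    · simpa using (le_max_left _ _).trans_lt hn
    · simpa using (le_max_right _ _).trans_lt hn
  have hall := (ae_restrict_iUnion_iff _ _).2 hball
  rw [hU, Measure.restrict_univ] at hall
  exact (Lp.eq_zero_iff_ae_eq_zero).2 hall

theorem aeFst {P : Pos m → Prop} (h : ∀ᵐ x, P x) : ∀ᵐ p : Pos m × Pos m, P p.1 :=
  Measure.quasiMeasurePreserving_fst.ae h

theorem aeSnd {P : Pos m → Prop} (h : ∀ᵐ x, P x) : ∀ᵐ p : Pos m × Pos m, P p.2 :=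
  Measure.quasiMeasurePreserving_snd.ae h

/-- `tensorVec` as a bilinear map. -/
def tensorBilin (m : ℕ) : ModeSpace m →ₗ[ℂ] ModeSpace m →ₗ[ℂ] TwoModeSpace m :=
  LinearMap.mk₂ ℂ tensorVec
    (by
      intro f f' g
      rw [tensorVec, tensorVec, tensorVec, ← MemLp.toLp_add]
      refine MemLp.toLp_congr _ _ ?_
      filter_upwards [aeFst (Lp.coeFn_add f f')] with p hp
      simp only [Pi.add_apply] at hp ⊢
      rw [hp]; ring)
    (by
      intro c f g
      rw [tensorVec, tensorVec, ← MemLp.toLp_const_smul]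
      refine MemLp.toLp_congr _ _ ?_
      filter_upwards [aeFst (Lp.coeFn_smul c f)] with p hp
      simp only [Pi.smul_apply, smul_eq_mul] at hp ⊢
      rw [hp]; ring)
    (by
      intro f g g'
      rw [tensorVec, tensorVec, tensorVec, ← MemLp.toLp_add]
      refine MemLp.toLp_congr _ _ ?_
      filter_upwards [aeSnd (Lp.coeFn_add g g')] with p hp
      simp only [Pi.add_apply] at hp ⊢
      rw [hp]; ring)
    (by
      intro c f g
      rw [tensorVec, tensorVec, ← MemLp.toLp_const_smul]
      refine MemLp.toLp_congr _ _ ?_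
      filter_upwards [aeSnd (Lp.coeFn_smul c g)] with p hp
      simp only [Pi.smul_apply, smul_eq_mul] at hp ⊢
      rw [hp]; ring)

open TensorProduct in
/-- The isometric embedding of the algebraic tensor product into `L²(ℝᵐ × ℝᵐ)`. -/
def tensorEmbed (m : ℕ) : (ModeSpace m ⊗[ℂ] ModeSpace m) →ₗᵢ[ℂ] TwoModeSpace m :=
  (TensorProduct.lift (tensorBilin m)).isometryOfInner (by
    intro x y
    induction x using TensorProduct.induction_on with
    | zero => simp
    | add a b ha hb => simp only [map_add, inner_add_left, ha, hb]
    | tmul f g =>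
      induction y using TensorProduct.induction_on with
      | zero => simp
      | add a b ha hb => simp only [map_add, inner_add_right, ha, hb]
      | tmul f' g' => simp [tensorBilin, inner_tensorVec])

section MapBound

open TensorProduct

variable {H K : Type} [NormedAddCommGroup H] [InnerProductSpace ℂ H] [CompleteSpace H]
  [NormedAddCommGroup K] [InnerProductSpace ℂ K]

theorem inner_rTensor (A : H →L[ℂ] H) (x y : H ⊗[ℂ] K) :
    inner ℂ (A.toLinearMap.rTensor K x) y
      = inner ℂ x ((ContinuousLinearMap.adjoint A).toLinearMap.rTensor K y) := by
  induction x using TensorProduct.induction_on with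
  | zero => simp
  | add a b ha hb => simp only [map_add, inner_add_left, ha, hb]
  | tmul f g =>
    induction y using TensorProduct.induction_on with
    | zero => simp
    | add a b ha hb => simp only [map_add, inner_add_right, ha, hb]
    | tmul f' g' => simp [ContinuousLinearMap.adjoint_inner_right]

theorem norm_rTensor_le (A : H →L[ℂ] H) (x : H ⊗[ℂ] K) :
    ‖A.toLinearMap.rTensor K x‖ ≤ ‖A‖ * ‖x‖ := by
  -- `‖A‖² - A†A` is positive, hence of the form `C†C`
  have hpos : (0 : H →L[ℂ] H) ≤ ((‖A‖ ^ 2 : ℝ) : ℂ) • ContinuousLinearMap.id ℂ H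
      - ContinuousLinearMap.adjoint A ∘L A := by
    have := CStarAlgebra.star_mul_le_algebraMap_norm_sq (a := A)
    rw [sub_nonneg]
    have h : (algebraMap ℝ (H →L[ℂ] H)) (‖A‖ ^ 2)
        = ((‖A‖ ^ 2 : ℝ) : ℂ) • ContinuousLinearMap.id ℂ H := by
      ext v
      simp [Algebra.algebraMap_eq_smul_one, -Complex.ofReal_pow, Complex.coe_smul]
    rw [← h]
    exact this
  obtain ⟨C, hC⟩ := CStarAlgebra.nonneg_iff_eq_star_mul_self.1 hpos
  have h1 : inner ℂ (C.toLinearMap.rTensor K x) (C.toLinearMap.rTensor K x)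
      = ((‖A‖ ^ 2 : ℝ) : ℂ) * inner ℂ x x
        - inner ℂ (A.toLinearMap.rTensor K x) (A.toLinearMap.rTensor K x) := by
    rw [inner_rTensor, inner_rTensor, ← LinearMap.comp_apply, ← LinearMap.comp_apply,
      ← LinearMap.rTensor_comp, ← LinearMap.rTensor_comp]
    have hC' : (ContinuousLinearMap.adjoint C).toLinearMap ∘ₗ C.toLinearMap
        = ((‖A‖ ^ 2 : ℝ) : ℂ) • LinearMap.id
          - (ContinuousLinearMap.adjoint A).toLinearMap ∘ₗ A.toLinearMap := by
      ext v
      exact (DFunLike.congr_fun hC v).symm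
    rw [hC', LinearMap.rTensor_sub, LinearMap.rTensor_smul, LinearMap.rTensor_id,
      LinearMap.sub_apply, LinearMap.smul_apply, LinearMap.id_apply]
    refine (inner_sub_right x _ _).trans (congrArg (· - _) ?_)
    exact inner_smul_right x x _
  have hn : ∀ y : H ⊗[ℂ] K, inner ℂ y y = (‖y‖ : ℂ) ^ 2 := fun y => inner_self_eq_norm_sq_to_K y
  rw [hn, hn, hn] at h1
  have h2 : ‖C.toLinearMap.rTensor K x‖ ^ 2
      = ‖A‖ ^ 2 * ‖x‖ ^ 2 - ‖A.toLinearMap.rTensor K x‖ ^ 2 := by exact_mod_cast h1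
  refine le_of_sq_le_sq ?_ (by positivity)
  rw [mul_pow]
  nlinarith [sq_nonneg ‖C.toLinearMap.rTensor K x‖]

theorem norm_map_le [CompleteSpace K] (A : H →L[ℂ] H) (B : K →L[ℂ] K) (x : H ⊗[ℂ] K) :
    ‖TensorProduct.map A.toLinearMap B.toLinearMap x‖ ≤ ‖A‖ * ‖B‖ * ‖x‖ := by
  have h : TensorProduct.map A.toLinearMap B.toLinearMap x
      = A.toLinearMap.rTensor K (TensorProduct.comm ℂ K H
          (B.toLinearMap.rTensor H (TensorProduct.comm ℂ H K x))) := by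
    induction x using TensorProduct.induction_on with
    | zero => simp
    | add a b ha hb => simp only [map_add, ha, hb]
    | tmul f g => simp
  rw [h, mul_assoc]
  refine (norm_rTensor_le A _).trans (mul_le_mul_of_nonneg_left ?_ (norm_nonneg _))
  rw [TensorProduct.norm_comm]
  refine (norm_rTensor_le B _).trans (le_of_eq ?_)
  rw [TensorProduct.norm_comm]

/-- The operator `A ⊗ B` on the algebraic tensor product, as a bounded operator. -/
def algTensorOp [CompleteSpace K] (A : H →L[ℂ] H) (B : K →L[ℂ] K) : H ⊗[ℂ] K →L[ℂ] H ⊗[ℂ] K :=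
  (TensorProduct.map A.toLinearMap B.toLinearMap).mkContinuous (‖A‖ * ‖B‖) (norm_map_le A B)

end MapBound

/-- The isometric embedding of the completed tensor product `L²(ℝᵐ) ⊗ L²(ℝᵐ)` into
`L²(ℝᵐ × ℝᵐ)` that maps `f ⊗ g` to the function `(x, y) ↦ f(x) g(y)` -/
def tensorEmbedCompl (m : ℕ) :
    UniformSpace.Completion (TensorProduct ℂ (ModeSpace m) (ModeSpace m)) →L[ℂ] TwoModeSpace m :=
  (tensorEmbed m).toContinuousLinearMap.fromCompletion

/-- The bounded operator `A ⊗ B` on `L²(ℝᵐ × ℝᵐ) = L²(ℝᵐ) ⊗ L²(ℝᵐ)`. -/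
def tensorOp (A B : ModeSpace m →L[ℂ] ModeSpace m) : TwoModeSpace m →L[ℂ] TwoModeSpace m :=
  tensorEmbedCompl m ∘L (algTensorOp A B).completion ∘L
    ContinuousLinearMap.adjoint (tensorEmbedCompl m)

theorem tensorOp_tensorVec (A B : ModeSpace m →L[ℂ] ModeSpace m) (f g : ModeSpace m) :
    tensorOp A B (tensorVec f g) = tensorVec (A f) (B g) := by
  have h1 : ∀ f g : ModeSpace m,
      tensorEmbedCompl m (((TensorProduct.tmul ℂ f g : TensorProduct ℂ _ _)) :
        UniformSpace.Completion (TensorProduct ℂ (ModeSpace m) (ModeSpace m))) = tensorVec f g := by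
    intro f g
    rw [tensorEmbedCompl, ContinuousLinearMap.fromCompletion_apply_coe]
    rfl
  have h2 : ContinuousLinearMap.adjoint (tensorEmbedCompl m) ∘L tensorEmbedCompl m
      = ContinuousLinearMap.id ℂ _ := by
    rw [← ContinuousLinearMap.one_def, ← ContinuousLinearMap.norm_map_iff_adjoint_comp_self]
    intro x
    induction x using UniformSpace.Completion.induction_on with
    | hp => exact isClosed_eq (by fun_prop) (by fun_prop)
    | ih x =>
      rw [tensorEmbedCompl, ContinuousLinearMap.fromCompletion_apply_coe,
        UniformSpace.Completion.norm_coe]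
      exact (tensorEmbed m).norm_map x
  rw [← h1 f g, tensorOp, ContinuousLinearMap.comp_apply, ContinuousLinearMap.comp_apply,
    ← ContinuousLinearMap.comp_apply (ContinuousLinearMap.adjoint _), h2,
    ContinuousLinearMap.id_apply, ContinuousLinearMap.completion_apply_coe, ← h1]
  rfl

/-- `tensorOp A B` is the only bounded operator that maps `f ⊗ g` to `A f ⊗ B g`. -/
theorem eq_tensorOp (A B : ModeSpace m →L[ℂ] ModeSpace m)
    (T : TwoModeSpace m →L[ℂ] TwoModeSpace m)
    (hT : ∀ f g, T (tensorVec f g) = tensorVec (A f) (B g)) : T = tensorOp A B := by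
  have h : ContinuousLinearMap.adjoint (T - tensorOp A B) = 0 := by
    ext1 Ψ
    refine tensorVec_total _ fun f g => ?_
    rw [ContinuousLinearMap.adjoint_inner_right]
    simp [hT, tensorOp_tensorVec]
  rw [← sub_eq_zero, ← ContinuousLinearMap.adjoint_adjoint (T - tensorOp A B), h, map_zero]

/-! ### Partial trace -/

theorem norm_tensorVec (f g : ModeSpace m) : ‖tensorVec f g‖ = ‖f‖ * ‖g‖ := by
  have h := inner_tensorVec f g f g
  simp only [inner_self_eq_norm_sq_to_K] at h
  have h' : ‖tensorVec f g‖ ^ 2 = (‖f‖ * ‖g‖) ^ 2 := by rw [mul_pow]; exact_mod_cast h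
  exact (sq_eq_sq₀ (norm_nonneg _) (by positivity)).1 h'

/-- The bounded map `f ↦ f ⊗ g`. -/
def tensorRight (g : ModeSpace m) : ModeSpace m →L[ℂ] TwoModeSpace m :=
  ((tensorBilin m).flip g).mkContinuous ‖g‖ fun f => by
    rw [mul_comm]; exact (norm_tensorVec f g).le

/-- `T` has a well-defined partial trace over the second set of modes, equal to `τ`: for every
orthonormal basis `b` of `L²(ℝᵐ)`, `∑ⱼ (1 ⊗ ⟨b j|) T (1 ⊗ |b j⟩) = τ`, with unconditional
convergence in norm.  This holds for every trace class operator `T`. -/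
def HasPartialTrace (T : TwoModeSpace m →L[ℂ] TwoModeSpace m)
    (τ : ModeSpace m →L[ℂ] ModeSpace m) : Prop :=
  ∀ (ι : Type) (b : HilbertBasis ι ℂ (ModeSpace m)),
    HasSum (fun j => ContinuousLinearMap.adjoint (tensorRight (b j)) ∘L T ∘L tensorRight (b j)) τ

theorem HasPartialTrace.unique {T : TwoModeSpace m →L[ℂ] TwoModeSpace m}
    {τ τ' : ModeSpace m →L[ℂ] ModeSpace m} (h : HasPartialTrace T τ) (h' : HasPartialTrace T τ') :
    τ = τ' := by
  obtain ⟨w, b, -⟩ := exists_hilbertBasis ℂ (ModeSpace m)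
  exact (h w b).unique (h' w b)

open Classical in
/-- The partial trace over the second set of modes (zero if it is not well defined). -/
def partialTrace (T : TwoModeSpace m →L[ℂ] TwoModeSpace m) : ModeSpace m →L[ℂ] ModeSpace m :=
  if h : ∃ τ, HasPartialTrace T τ then h.choose else 0

theorem HasPartialTrace.partialTrace_eq {T : TwoModeSpace m →L[ℂ] TwoModeSpace m}
    {τ : ModeSpace m →L[ℂ] ModeSpace m} (h : HasPartialTrace T τ) : partialTrace T = τ := by
  have h' : ∃ τ, HasPartialTrace T τ := ⟨τ, h⟩
  rw [partialTrace, dif_pos h']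
  exact h'.choose_spec.unique h

/-! ### Quantum convolution, characteristic function and Wigner function -/

/-- The quantum convolution `ρ ⊞_t σ = Tr₂ [U_t (ρ ⊗ σ) U_t†]`. -/
def quantumConv (t : ℝ) (ρ σ : ModeSpace m →L[ℂ] ModeSpace m) : ModeSpace m →L[ℂ] ModeSpace m :=
  partialTrace (beamSplitter m t ∘L tensorOp ρ σ ∘L ContinuousLinearMap.adjoint (beamSplitter m t))

/-- The quantum characteristic function `χ_T(z) = Tr [T D(z)]`. -/
def quantumCharFun (T : ModeSpace m →L[ℂ] ModeSpace m) (z : Fin m → ℂ) : ℂ :=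
  trace (T ∘L displacement z)

/-- The Wigner function `W_T(z) = ∫ d^{2m}w / π^{2m} χ_T(w) exp (∑ⱼ (z_j w_j* - z_j* w_j))`. -/
def wigner (T : ModeSpace m →L[ℂ] ModeSpace m) (z : Fin m → ℂ) : ℂ :=
  ∫ w : Fin m → ℂ, quantumCharFun T w / (Real.pi : ℂ) ^ (2 * m) *
    Complex.exp (∑ j, (z j * starRingEnd ℂ (w j) - starRingEnd ℂ (z j) * w j))

end CV

end

/-! Write both states as countable mixtures ρ = ∑ |v i⟩⟨v i| and σ = ∑ |u j⟩⟨u j| with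
square-summable norms (`IsDensityOperator.exists_hasSum_rankOne`). Everything then reduces to matrix
elements of displacement operators on pure vectors, plus control of the double series.

On the beam splitter, D(z) ⊗ 1 at the output corresponds to D(z/√2) ⊗ D(z/√2) at the input. Hence
the characteristic function of the convolution at z is ∑ ⟨v i, D(z/√2) v i⟩ ⟨u j, D(z/√2) u j⟩
(`quantumCharFun_quantumConv`).

The analytic input is Moyal's identity (`integral_conj_inner_displacement_mul`): ∫ conj⟨f, D(w) g⟩
⟨f', D(w) g'⟩ dw = π^m ⟨f', f⟩ ⟨g, g'⟩. For a fixed shift, the matrix element is a phase times a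
Fourier transform, so Plancherel and Fubini give it. It makes every term of the series a product of
two L² functions whose L¹ norm is at most π^m ‖v i‖² ‖u j‖²; this is summable, so the characteristic
function is integrable and sum and integral commute.

For the value, the rescaling w ↦ √2 w has Jacobian 2^m and replaces z by α = √2 z in the
exponential. The Weyl relation and J D(w) J = D(w)† turn ⟨u, D(w) u⟩ times that exponential into the
conjugate of ⟨D(α)Ju, D(w) D(α)Ju⟩ (`conj_inner_displaced_parity`). Moyal's identity then gives π^m
|⟨v, D(α)Ju⟩|² for each pair. Summed over pairs this is π^m Tr[ρ D(α)JσJ D(α)†], a sum of squares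
(`overlapSum`, `hasTrace_overlap`), hence the nonnegativity. -/

noncomputable section

namespace CV

variable {m : ℕ}

/-! ### Plancherel's formula for the Fourier integral on L¹ ∩ L² -/

section Plancherel

open FourierTransform SchwartzMap
open scoped ContDiff

variable {E : Type*} [NormedAddCommGroup E] [InnerProductSpace ℝ E] [FiniteDimensional ℝ E]
  [MeasurableSpace E] [BorelSpace E]

/-- On `L¹ ∩ L²` the Fourier integral agrees with the Fourier transform of `L²`. -/
theorem fourier_toLp_ae_eq {f : E → ℂ} (hf : Integrable f) (hf2 : MemLp f 2) :
    (𝓕 (hf2.toLp f) : Lp ℂ 2 (volume : Measure E)) =ᵐ[volume] 𝓕 f := by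
  have hcont : Continuous (𝓕 f) := VectorFourier.fourierIntegral_continuous
    Real.continuous_fourierChar continuous_inner hf
  refine ae_eq_of_integral_contDiff_smul_eq
    ((Lp.memLp _).locallyIntegrable (by norm_num)) hcont.locallyIntegrable fun g hg hgs => ?_
  have hgc : HasCompactSupport (fun x => (g x : ℂ)) := hgs.comp_left (g := ((↑) : ℝ → ℂ)) rfl
  have hgd : ContDiff ℝ ∞ (fun x => (g x : ℂ)) := Complex.ofRealCLM.contDiff.comp hg
  set φ : 𝓢(E, ℂ) := hgc.toSchwartzMap hgd with hφ
  have hφg : ∀ x, φ x = (g x : ℂ) := fun x => rfl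
  -- Both transforms satisfy ∫ 𝓕φ · f = ∫ φ · 𝓕f against a test function φ: the L² one through
  -- tempered distributions, the integral one by Fubini. Smooth compactly supported φ determine a
  -- locally integrable function almost everywhere.
  have h1 := DFunLike.congr_fun (Lp.fourier_toTemperedDistribution_eq (hf2.toLp f)) φ
  rw [TemperedDistribution.fourier_apply, Lp.toTemperedDistribution_apply,
    Lp.toTemperedDistribution_apply] at h1
  have h2 := VectorFourier.integral_fourierIntegral_smul_eq_flip (L := innerₗ E)
    Real.continuous_fourierChar continuous_inner (φ.integrable (μ := volume)) hf
  have h3 : ∫ x, (𝓕 φ) x • (hf2.toLp f) x = ∫ x, (𝓕 φ) x • f x := by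
    refine integral_congr_ae ?_
    filter_upwards [hf2.coeFn_toLp] with x hx
    rw [hx]
  rw [flip_innerₗ] at h2
  have h4 : ∫ x, φ x • (𝓕 (hf2.toLp f) : Lp ℂ 2 (volume : Measure E)) x = ∫ x, φ x • 𝓕 f x :=
    h1.symm.trans (h3.trans h2)
  simpa only [hφg, smul_eq_mul, ← Complex.real_smul] using h4

theorem memLp_fourier {f : E → ℂ} (hf : Integrable f) (hf2 : MemLp f 2) : MemLp (𝓕 f) 2 :=
  (memLp_congr_ae (fourier_toLp_ae_eq hf hf2)).1 (Lp.memLp _)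

/-- Plancherel's formula on `L¹ ∩ L²`. -/
theorem integral_conj_fourier_mul_fourier {f g : E → ℂ} (hf : Integrable f) (hf2 : MemLp f 2)
    (hg : Integrable g) (hg2 : MemLp g 2) :
    ∫ ξ, starRingEnd ℂ (𝓕 f ξ) * 𝓕 g ξ = ∫ x, starRingEnd ℂ (f x) * g x := by
  have h := Lp.inner_fourier_eq (hf2.toLp f) (hg2.toLp g)
  rw [L2.inner_def, L2.inner_def] at h
  refine Eq.trans (integral_congr_ae ?_) (h.trans (integral_congr_ae ?_))
  · filter_upwards [fourier_toLp_ae_eq hf hf2, fourier_toLp_ae_eq hg hg2] with x h1 h2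
    rw [h1, h2, RCLike.inner_apply, mul_comm]
  · filter_upwards [hf2.coeFn_toLp, hg2.coeFn_toLp] with x h1 h2
    rw [h1, h2, RCLike.inner_apply, mul_comm]

end Plancherel

/-! ### Fubini for a(x) b(x - √2 r) -/

section Correlation

theorem measurable_sub_sqrt_two_smul :
    Measurable fun p : Pos m × Pos m => p.2 - √2 • p.1 := by fun_prop

theorem integral_comp_sub_smul {F : Type*} [NormedAddCommGroup F] [NormedSpace ℝ F]
    (b : Pos m → F) (x : Pos m) :
    ∫ r, b (x - √2 • r) = (√2 ^ m)⁻¹ • ∫ y, b y := by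
  rw [Measure.integral_comp_smul_of_nonneg volume (fun y => b (x - y)) √2 (hR := by positivity),
    integral_sub_left_eq_self, finrank_euclideanSpace_fin]

/-- Integrating over r first decouples the factors: by translation invariance and scaling, the inner
integral of ‖b‖ does not depend on x. -/
theorem integrable_correlation {a b : Pos m → ℂ} (ha : Integrable a) (hb : Integrable b)
    (ham : StronglyMeasurable a) (hbm : StronglyMeasurable b) :
    Integrable (fun p : Pos m × Pos m => a p.2 * b (p.2 - √2 • p.1)) volume := by
  have hm : StronglyMeasurable (fun p : Pos m × Pos m => a p.2 * b (p.2 - √2 • p.1)) :=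
    (ham.comp_measurable measurable_snd).mul (hbm.comp_measurable measurable_sub_sqrt_two_smul)
  rw [Measure.volume_eq_prod, integrable_prod_iff' hm.aestronglyMeasurable]
  refine ⟨.of_forall fun x => ?_, ?_⟩
  · have h : Integrable fun r => b (x - √2 • r) :=
      (integrable_comp_smul_iff volume (fun y => b (x - y)) (by positivity : √2 ≠ 0)).2
        (hb.comp_sub_left x)
    exact h.const_mul (a x)
  · simp only [norm_mul, integral_const_mul]
    have h : ∀ x : Pos m, ∫ r, ‖b (x - √2 • r)‖ = (√2 ^ m)⁻¹ • ∫ y, ‖b y‖ := fun x =>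
      integral_comp_sub_smul (fun y => ‖b y‖) x
    simp only [h]
    exact ha.norm.mul_const _

theorem integral_correlation {a b : Pos m → ℂ} (ha : Integrable a) (hb : Integrable b)
    (ham : StronglyMeasurable a) (hbm : StronglyMeasurable b) :
    ∫ r, ∫ x, a x * b (x - √2 • r) = ((√2 ^ m)⁻¹ : ℝ) * ((∫ x, a x) * ∫ y, b y) := by
  rw [integral_integral_swap (integrable_correlation ha hb ham hbm)]
  simp only [integral_const_mul, integral_comp_sub_smul, integral_mul_const, Complex.real_smul]
  ring

end Correlation

/-! ### The cross ambiguity function and Moyal's identity -/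

section Ambiguity

open FourierTransform

/-- The product `x ↦ conj (f x) g (x - √2 r)`. -/
def overlap (f g : ModeSpace m) (r x : Pos m) : ℂ :=
  starRingEnd ℂ (f x) * g (x - √2 • r)

/-- The frequency scale between the displacement parameter and the Fourier variable. -/
def freqScale : ℝ := -√2 / (2 * Real.pi)

theorem freqScale_ne_zero : freqScale ≠ 0 := 
  div_ne_zero (neg_ne_zero.2 (by positivity)) Real.two_pi_pos.ne'

theorem stronglyMeasurable_overlap (f g : ModeSpace m) :
    StronglyMeasurable (fun p : Pos m × Pos m => overlap f g p.1 p.2) :=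
  (Complex.continuous_conj.comp_stronglyMeasurable
    ((Lp.stronglyMeasurable f).comp_measurable measurable_snd)).mul
    ((Lp.stronglyMeasurable g).comp_measurable measurable_sub_sqrt_two_smul)

theorem integrable_overlap (f g : ModeSpace m) (r : Pos m) : Integrable (overlap f g r) := by
  have h1 : MemLp (fun x => starRingEnd ℂ (f x)) 2 (volume : Measure (Pos m)) :=
    (Lp.memLp f).star
  have h2 : MemLp (fun x => g (x - √2 • r)) 2 (volume : Measure (Pos m)) :=
    (Lp.memLp g).comp_measurePreserving (measurePreserving_sub_right volume _)
  exact h1.integrable_mul h2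

theorem integrable_mul_conj (f f' : ModeSpace m) :
    Integrable fun x => f x * starRingEnd ℂ (f' x) :=
  (Lp.memLp f).integrable_mul (Lp.memLp f').star

theorem stronglyMeasurable_mul_conj (f f' : ModeSpace m) :
    StronglyMeasurable fun x => f x * starRingEnd ℂ (f' x) :=
  (Lp.stronglyMeasurable f).mul
    (Complex.continuous_conj.comp_stronglyMeasurable (Lp.stronglyMeasurable f'))

theorem integral_mul_conj (f f' : ModeSpace m) :
    ∫ x, f x * starRingEnd ℂ (f' x) = inner ℂ f' f := by
  simp only [L2.inner_def, RCLike.inner_apply]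

theorem conj_overlap_mul_overlap (f g f' g' : ModeSpace m) (r x : Pos m) :
    starRingEnd ℂ (overlap f g r x) * overlap f' g' r x
      = (f x * starRingEnd ℂ (f' x))
        * (g' (x - √2 • r) * starRingEnd ℂ (g (x - √2 • r))) := by
  simp only [overlap, map_mul, Complex.conj_conj]; ring

theorem integrable_conj_overlap_mul_overlap (f g f' g' : ModeSpace m) :
    Integrable (fun p : Pos m × Pos m =>
      starRingEnd ℂ (overlap f g p.1 p.2) * overlap f' g' p.1 p.2) volume := by
  simp only [conj_overlap_mul_overlap]
  exact integrable_correlation (a := fun x => f x * starRingEnd ℂ (f' x))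
    (b := fun y => g' y * starRingEnd ℂ (g y)) (integrable_mul_conj f f') (integrable_mul_conj g' g)
    (stronglyMeasurable_mul_conj f f') (stronglyMeasurable_mul_conj g' g)

theorem integral_conj_overlap_mul_overlap (f g f' g' : ModeSpace m) :
    ∫ r, ∫ x, starRingEnd ℂ (overlap f g r x) * overlap f' g' r x
      = ((√2 ^ m)⁻¹ : ℝ) * (inner ℂ f' f * inner ℂ g g') := by
  simp only [conj_overlap_mul_overlap]
  rw [integral_correlation (a := fun x => f x * starRingEnd ℂ (f' x))
    (b := fun y => g' y * starRingEnd ℂ (g y)) (integrable_mul_conj f f') (integrable_mul_conj g' g)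
    (stronglyMeasurable_mul_conj f f') (stronglyMeasurable_mul_conj g' g),
    integral_mul_conj, integral_mul_conj]

/-- A product of two L² functions is only L¹ in general. The squared modulus is however integrable
jointly in (r, x), so Fubini makes almost every slice square integrable, which is what Plancherel
needs. -/
theorem ae_memLp_overlap (f g : ModeSpace m) : ∀ᵐ r, MemLp (overlap f g r) 2 volume := by
  have h := integrable_conj_overlap_mul_overlap f g f g
  rw [Measure.volume_eq_prod] at h
  filter_upwards [h.prod_right_ae] with r hr
  rw [memLp_two_iff_integrable_sq_norm (integrable_overlap f g r).1]
  refine hr.norm.congr (.of_forall fun x => ?_)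
  simp [sq]

/-- The cross ambiguity function, `⟨f, D(r + i t) g⟩` as a function of `(r, t)`. -/
def ambiguity (f g : ModeSpace m) (p : Pos m × Pos m) : ℂ :=
  Complex.exp (Complex.I * ((-inner ℝ p.2 p.1 : ℝ) : ℂ)) * 𝓕 (overlap f g p.1) (freqScale • p.2)

/-- The part of the displacement phase linear in x is a Fourier character: `freqScale` is the
constant for which -2π x·ξ becomes √2 t·x. The remaining part does not depend on x and is the
exponential prefactor of `ambiguity`. -/
theorem inner_displacement (f g : ModeSpace m) (w : Fin m → ℂ) :
    inner ℂ f (displacement w g) = ambiguity f g (rePart w, imPart w) := by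
  rw [L2.inner_def, ambiguity, Real.fourier_eq, ← integral_const_mul]
  refine integral_congr_ae ?_
  filter_upwards [displacement_coeFn w g] with x hx
  rw [RCLike.inner_apply, hx, dispFun, overlap, dispPhase, Circle.smul_def, Real.fourierChar_apply,
    smul_eq_mul, ← mul_assoc, ← Complex.exp_add]
  have : Complex.I * ((√2 * inner ℝ (imPart w) x - inner ℝ (imPart w) (rePart w) : ℝ) : ℂ)
      = Complex.I * ((-inner ℝ (imPart w) (rePart w) : ℝ) : ℂ)
        + ((2 * Real.pi * -inner ℝ x (freqScale • imPart w) : ℝ) : ℂ) * Complex.I := by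
    have h : 2 * Real.pi * -inner ℝ x (freqScale • imPart w) = √2 * inner ℝ (imPart w) x := by
      rw [inner_smul_right, real_inner_comm, freqScale]
      field_simp
    rw [h]; push_cast; ring
  rw [this]
  ring

theorem stronglyMeasurable_ambiguity (f g : ModeSpace m) :
    StronglyMeasurable (ambiguity f g) := by
  have h1 : Continuous fun p : Pos m × Pos m =>
      Complex.exp (Complex.I * ((-inner ℝ p.2 p.1 : ℝ) : ℂ)) := by fun_prop
  refine h1.stronglyMeasurable.mul ?_
  simp only [Real.fourier_eq]
  have h2 : Continuous fun q : (Pos m × Pos m) × Pos m =>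
      (Real.fourierChar (-inner ℝ q.2 (freqScale • q.1.2)) : ℂ) := by
    simp only [Real.fourierChar_apply]
    fun_prop
  have h4 : Measurable fun q : (Pos m × Pos m) × Pos m => (q.1.1, q.2) := by fun_prop
  have h3 : StronglyMeasurable fun q : (Pos m × Pos m) × Pos m => overlap f g q.1.1 q.2 :=
    (stronglyMeasurable_overlap f g).comp_measurable h4
  exact (h2.stronglyMeasurable.mul h3).integral_prod_right'

/-- The prefactor depends only on (r, t) and has modulus one, so it cancels in sesquilinear
products. Only Fourier transforms remain, and Plancherel applies. -/
theorem conj_ambiguity_mul_ambiguity (f g f' g' : ModeSpace m) (r t : Pos m) :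
    starRingEnd ℂ (ambiguity f g (r, t)) * ambiguity f' g' (r, t)
      = starRingEnd ℂ (𝓕 (overlap f g r) (freqScale • t))
        * 𝓕 (overlap f' g' r) (freqScale • t) := by
  have h : starRingEnd ℂ (Complex.exp (Complex.I * ((-inner ℝ t r : ℝ) : ℂ)))
      * Complex.exp (Complex.I * ((-inner ℝ t r : ℝ) : ℂ)) = 1 := by
    rw [← Complex.exp_conj, ← Complex.exp_add]
    simp
  simp only [ambiguity, map_mul]
  linear_combination (starRingEnd ℂ (𝓕 (overlap f g r) (freqScale • t))
        * 𝓕 (overlap f' g' r) (freqScale • t)) * h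

theorem integral_slice_ambiguity (f g f' g' : ModeSpace m) {r : Pos m}
    (h : MemLp (overlap f g r) 2 volume) (h' : MemLp (overlap f' g' r) 2 volume) :
    ∫ t, starRingEnd ℂ (ambiguity f g (r, t)) * ambiguity f' g' (r, t)
      = (|(freqScale ^ m)⁻¹| : ℝ) * ∫ x, starRingEnd ℂ (overlap f g r x) * overlap f' g' r x := by
  simp only [conj_ambiguity_mul_ambiguity]
  rw [Measure.integral_comp_smul volume (fun t => starRingEnd ℂ (𝓕 (overlap f g r) t)
        * 𝓕 (overlap f' g' r) t), integral_conj_fourier_mul_fourier (integrable_overlap f g r) h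
        (integrable_overlap f' g' r) h', finrank_euclideanSpace_fin, Complex.real_smul]

/-- Tonelli on the squared modulus: slices in t are integrable by Plancherel for almost every r, and
their integrals are a constant times the L² norms squared of the overlaps, which are integrable in
r. -/
theorem memLp_ambiguity (f g : ModeSpace m) : MemLp (ambiguity f g) 2 volume := by
  have hm := (stronglyMeasurable_ambiguity f g).aestronglyMeasurable (μ := volume)
  rw [memLp_two_iff_integrable_sq_norm hm, Measure.volume_eq_prod,
    integrable_prod_iff (f := fun p => ‖ambiguity f g p‖ ^ 2) (hm.norm.pow 2)]
  have hn : ∀ r t, ‖ambiguity f g (r, t)‖ ^ 2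
      = (starRingEnd ℂ (ambiguity f g (r, t)) * ambiguity f g (r, t)).re := by
    intro r t
    rw [mul_comm, Complex.mul_conj, Complex.ofReal_re, Complex.normSq_eq_norm_sq]
  have hi : ∀ r, MemLp (overlap f g r) 2 volume → Integrable fun t =>
      starRingEnd ℂ (ambiguity f g (r, t)) * ambiguity f g (r, t) := by
    intro r hr
    simp only [conj_ambiguity_mul_ambiguity]
    have := memLp_fourier (integrable_overlap f g r) hr
    exact (integrable_comp_smul_iff volume (fun t => starRingEnd ℂ (𝓕 (overlap f g r) t)
        * 𝓕 (overlap f g r) t) freqScale_ne_zero).2 (this.star.integrable_mul this)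
  constructor
  · filter_upwards [ae_memLp_overlap f g] with r hr
    simp only [hn]
    exact (hi r hr).re
  · have h := integrable_conj_overlap_mul_overlap f g f g
    rw [Measure.volume_eq_prod] at h
    refine (h.integral_prod_left.re.const_mul |(freqScale ^ m)⁻¹|).congr ?_
    filter_upwards [ae_memLp_overlap f g] with r hr
    have h0 : ∀ t, ‖‖ambiguity f g (r, t)‖ ^ 2‖
        = (starRingEnd ℂ (ambiguity f g (r, t)) * ambiguity f g (r, t)).re := fun t => by
      rw [Real.norm_of_nonneg (by positivity), hn]
    simp only [h0]
    have h1 : ∫ t, (starRingEnd ℂ (ambiguity f g (r, t)) * ambiguity f g (r, t)).re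
        = (∫ t, starRingEnd ℂ (ambiguity f g (r, t)) * ambiguity f g (r, t)).re :=
      integral_re (hi r hr)
    rw [h1, integral_slice_ambiguity f g f g hr hr, Complex.re_ofReal_mul]
    rfl

/-- Moyal's identity. -/
theorem integral_conj_ambiguity_mul_ambiguity (f g f' g' : ModeSpace m) :
    ∫ p, starRingEnd ℂ (ambiguity f g p) * ambiguity f' g' p
      = (Real.pi : ℂ) ^ m * (inner ℂ f' f * inner ℂ g g') := by
  have hint : Integrable (fun p => starRingEnd ℂ (ambiguity f g p) * ambiguity f' g' p)
      (volume : Measure (Pos m × Pos m)) :=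
    (memLp_ambiguity f g).star.integrable_mul (memLp_ambiguity f' g')
  rw [Measure.volume_eq_prod] at hint ⊢
  rw [integral_prod _ hint]
  have h : ∀ᵐ r, ∫ t, starRingEnd ℂ (ambiguity f g (r, t)) * ambiguity f' g' (r, t)
      = (|(freqScale ^ m)⁻¹| : ℝ) * ∫ x, starRingEnd ℂ (overlap f g r x) * overlap f' g' r x := by
    filter_upwards [ae_memLp_overlap f g, ae_memLp_overlap f' g'] with r h1 h2
    exact integral_slice_ambiguity f g f' g' h1 h2
  rw [integral_congr_ae h, integral_const_mul, integral_conj_overlap_mul_overlap, ← mul_assoc,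
    ← Complex.ofReal_mul]
  congr 1
  -- The Jacobian of the frequency rescaling and that of the shift x - √2 r combine to π^m.
  have h2 : |(freqScale ^ m)⁻¹| * (√2 ^ m)⁻¹ = Real.pi ^ m := by
    have h3 : |freqScale| * √2 = Real.pi⁻¹ := by
      rw [freqScale, abs_div, abs_neg, abs_of_pos (by positivity : 0 < √2),
        abs_of_pos Real.two_pi_pos, div_mul_eq_mul_div, Real.mul_self_sqrt zero_le_two]
      field_simp
    rw [abs_inv, abs_pow, ← mul_inv, ← mul_pow, h3, inv_pow, inv_inv]
  rw [h2, Complex.ofReal_pow]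

end Ambiguity

/-! ### Weyl relations and conjugation by parity -/

section Weyl

/-- Translating the argument in the phase of D(α) contributes -2 Im α · Re w, whereas the quadratic
term of the phase of D(w + α) contributes both cross terms with coefficient -1. The difference is
the symplectic cocycle. -/
theorem displacement_displacement (w α : Fin m → ℂ) (f : ModeSpace m) :
    displacement w (displacement α f)
      = Complex.exp (Complex.I * ((inner ℝ (imPart w) (rePart α)
          - inner ℝ (imPart α) (rePart w) : ℝ) : ℂ)) • displacement (w + α) f := by
  have hr : rePart (w + α) = rePart w + rePart α := by ext j; simp [rePart]
  have hi : imPart (w + α) = imPart w + imPart α := by ext j; simp [imPart]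
  refine Lp.ext ?_
  filter_upwards [displacement_coeFn w (displacement α f), displacement_coeFn (w + α) f,
    Lp.coeFn_smul (Complex.exp (Complex.I * ((inner ℝ (imPart w) (rePart α)
          - inner ℝ (imPart α) (rePart w) : ℝ) : ℂ))) (displacement (w + α) f),
    (measurePreserving_shift w).quasiMeasurePreserving.ae (displacement_coeFn α f)]
    with x h1 h2 h3 h4
  rw [h1, h3, Pi.smul_apply, h2, dispFun, h4, dispFun, dispFun, smul_eq_mul, ← mul_assoc,
    ← mul_assoc, dispPhase, dispPhase, dispPhase, ← Complex.exp_add, ← Complex.exp_add, hr, hi]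
  congr 2
  · rw [← mul_add, ← mul_add, ← Complex.ofReal_add, ← Complex.ofReal_add]
    congr 2
    simp only [inner_add_left, inner_add_right, inner_sub_right, inner_smul_right]
    linear_combination (-inner ℝ (imPart α) (rePart w)) * Real.mul_self_sqrt zero_le_two
  · rw [smul_add, sub_sub]

theorem displacement_zero (f : ModeSpace m) : displacement 0 f = f := by
  refine Lp.ext ?_
  filter_upwards [displacement_coeFn 0 f] with x hx
  rw [hx, dispFun_zero]

theorem displacement_neg_displacement (w : Fin m → ℂ) (f : ModeSpace m) :
    displacement (-w) (displacement w f) = f := by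
  have hr : rePart (-w) = -rePart w := by ext j; simp [rePart]
  have hi : imPart (-w) = -imPart w := by ext j; simp [imPart]
  rw [displacement_displacement, neg_add_cancel, displacement_zero, hr, hi]
  simp

theorem inner_displacement_displacement (w : Fin m → ℂ) (f g : ModeSpace m) :
    inner ℂ (displacement w f) (displacement w g) = inner ℂ f g := by
  rw [L2.inner_def, L2.inner_def,
    ← integral_sub_right_eq_self (fun x => inner ℂ (f x) (g x)) (√2 • rePart w)]
  refine integral_congr_ae ?_
  filter_upwards [displacement_coeFn w f, displacement_coeFn w g] with x h1 h2
  rw [h1, h2, dispFun, dispFun, RCLike.inner_apply, RCLike.inner_apply, map_mul]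
  have : dispPhase w x * starRingEnd ℂ (dispPhase w x) = 1 := by
    rw [Complex.mul_conj, Complex.normSq_eq_norm_sq, norm_dispPhase]; simp
  linear_combination (g (x - √2 • rePart w) * starRingEnd ℂ (f (x - √2 • rePart w))) * this

theorem adjoint_displacement (w : Fin m → ℂ) :
    ContinuousLinearMap.adjoint (displacement w) = displacement (-w) := by
  refine ((ContinuousLinearMap.eq_adjoint_iff _ _).2 fun f g => ?_).symm
  have h := displacement_neg_displacement (-w) f
  rw [neg_neg] at h
  rw [← inner_displacement_displacement w, h]

theorem norm_displacement_apply (w : Fin m → ℂ) (f : ModeSpace m) : ‖displacement w f‖ = ‖f‖ := by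
  rw [← sq_eq_sq₀ (norm_nonneg _) (norm_nonneg _), ← inner_self_eq_norm_sq (𝕜 := ℂ),
    ← inner_self_eq_norm_sq (𝕜 := ℂ), inner_displacement_displacement]

theorem norm_parity_apply (f : ModeSpace m) : ‖parity m f‖ = ‖f‖ :=
  (Lp.compMeasurePreservingₗᵢ ℂ (fun x : Pos m => -x)
    (Measure.measurePreserving_neg volume)).norm_map f

/-- Used in two ways: the kernel of the Wigner transform is unimodular, and it is the commutation
factor of two displacements (twice the cocycle of `displacement_displacement`). -/
theorem sum_symplectic (z w : Fin m → ℂ) :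
    ∑ j, (z j * starRingEnd ℂ (w j) - starRingEnd ℂ (z j) * w j)
      = Complex.I * ((2 * (inner ℝ (imPart z) (rePart w) - inner ℝ (imPart w) (rePart z)) : ℝ) : ℂ)
    := by
  simp only [PiLp.inner_apply, rePart, imPart, RCLike.inner_apply, conj_trivial]
  rw [← Finset.sum_sub_distrib]
  push_cast
  rw [Finset.mul_sum, Finset.mul_sum]
  refine Finset.sum_congr rfl fun j _ => ?_
  apply Complex.ext
  · simp
  · simp
    ring

/-- The Weyl relation for the displaced and reflected vector `D(α) J u`. -/
theorem conj_inner_displaced_parity (α w : Fin m → ℂ) (u : ModeSpace m) :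
    starRingEnd ℂ (inner ℂ (displacement α (parity m u))
        (displacement w (displacement α (parity m u))))
      = inner ℂ u (displacement w u)
        * Complex.exp (∑ j, (α j * starRingEnd ℂ (w j) - starRingEnd ℂ (α j) * w j)) := by
  have h1 : displacement α (displacement w (parity m u))
      = Complex.exp (∑ j, (α j * starRingEnd ℂ (w j) - starRingEnd ℂ (α j) * w j))
        • displacement w (displacement α (parity m u)) := by
    rw [displacement_displacement, displacement_displacement, smul_smul, ← Complex.exp_add,
      sum_symplectic, ← mul_add, ← Complex.ofReal_add, add_comm w α]
    congr 4
    ring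
  -- The isometry D(α) drops out, and moving J across turns D(w) into D(-w) = D(w)†; this is where
  -- the complex conjugate comes from.
  have h2 : inner ℂ (displacement α (parity m u)) (displacement α (displacement w (parity m u)))
      = starRingEnd ℂ (inner ℂ u (displacement w u)) := by
    rw [inner_displacement_displacement, ← adjoint_parity,
      ContinuousLinearMap.adjoint_inner_left, adjoint_parity, parity_displacement_parity,
      ← adjoint_displacement, ContinuousLinearMap.adjoint_inner_right, inner_conj_symm]
  rw [h1, inner_smul_right] at h2
  have h3 := congrArg (starRingEnd ℂ) h2
  rw [Complex.conj_conj, map_mul] at h3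
  have h4 : starRingEnd ℂ (Complex.exp
      (∑ j, (α j * starRingEnd ℂ (w j) - starRingEnd ℂ (α j) * w j)))
      * Complex.exp (∑ j, (α j * starRingEnd ℂ (w j) - starRingEnd ℂ (α j) * w j)) = 1 := by
    rw [← Complex.exp_conj, ← Complex.exp_add, sum_symplectic, map_mul, Complex.conj_ofReal]
    simp
  rw [← h3, mul_right_comm, h4, one_mul]

end Weyl

/-! ### Moyal's identity on ℂ^m and the overlap formula -/

section PhaseSpace

/-- Lebesgue measure on ℂ^m is d(Re w) d(Im w) with no extra factor, so the constant π^m carries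
over unchanged. -/
theorem measurePreserving_rePart_imPart :
    MeasurePreserving (fun w : Fin m → ℂ => (rePart w, imPart w)) volume volume := by
  have h1 := volume_preserving_pi fun _ : Fin m => Complex.volume_preserving_equiv_real_prod
  have h2 := volume_measurePreserving_arrowProdEquivProdArrow ℝ ℝ (Fin m)
  have h3 := (PiLp.volume_preserving_toLp (Fin m)).prod (PiLp.volume_preserving_toLp (Fin m))
  exact h3.comp (h2.comp h1)

theorem memLp_inner_displacement (f g : ModeSpace m) :
    MemLp (fun w : Fin m → ℂ => inner ℂ f (displacement w g)) 2 volume := by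
  simp only [inner_displacement]
  exact (memLp_ambiguity f g).comp_measurePreserving measurePreserving_rePart_imPart

/-- Moyal's identity for matrix elements of displacement operators. -/
theorem integral_conj_inner_displacement_mul (f g f' g' : ModeSpace m) :
    ∫ w : Fin m → ℂ, starRingEnd ℂ (inner ℂ f (displacement w g)) * inner ℂ f' (displacement w g')
      = (Real.pi : ℂ) ^ m * (inner ℂ f' f * inner ℂ g g') := by
  rw [← integral_conj_ambiguity_mul_ambiguity,
    ← measurePreserving_rePart_imPart.map_eq, integral_map
      measurePreserving_rePart_imPart.aemeasurable]
  · simp only [inner_displacement]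
  · exact ((Complex.continuous_conj.comp_stronglyMeasurable
      (stronglyMeasurable_ambiguity f g)).mul
      (stronglyMeasurable_ambiguity f' g')).aestronglyMeasurable

theorem integral_norm_sq_inner_displacement (f : ModeSpace m) :
    ∫ w : Fin m → ℂ, ‖inner ℂ f (displacement w f)‖ ^ 2 = Real.pi ^ m * ‖f‖ ^ 4 := by
  have h := integral_conj_inner_displacement_mul f f f f
  have h1 : ∀ w : Fin m → ℂ, starRingEnd ℂ (inner ℂ f (displacement w f))
      * inner ℂ f (displacement w f) = ((‖inner ℂ f (displacement w f)‖ ^ 2 : ℝ) : ℂ) := by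
    intro w
    rw [mul_comm, Complex.mul_conj, Complex.normSq_eq_norm_sq]
  simp only [h1] at h
  rw [integral_complex_ofReal, inner_self_eq_norm_sq_to_K] at h
  have h' : (Real.pi : ℂ) ^ m * ((‖f‖ : ℂ) ^ 2 * (‖f‖ : ℂ) ^ 2)
      = ((Real.pi ^ m * ‖f‖ ^ 4 : ℝ) : ℂ) := by push_cast; ring
  exact_mod_cast h.trans h'

theorem integrable_inner_displacement_mul (f g : ModeSpace m) :
    Integrable fun w : Fin m → ℂ => inner ℂ f (displacement w f) * inner ℂ g (displacement w g) :=
  (memLp_inner_displacement f f).integrable_mul (memLp_inner_displacement g g)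

/-- Cauchy–Schwarz combined with the diagonal case of Moyal's identity. The bound is summable over
the pairs of a double mixture, which is what permits exchanging sum and integral later. -/
theorem integral_norm_inner_displacement_mul_le (f g : ModeSpace m) :
    ∫ w : Fin m → ℂ, ‖inner ℂ f (displacement w f) * inner ℂ g (displacement w g)‖
      ≤ Real.pi ^ m * (‖f‖ ^ 2 * ‖g‖ ^ 2) := by
  have h2 : ENNReal.ofReal 2 = 2 := by norm_num
  have h := integral_mul_le_Lp_mul_Lq_of_nonneg (μ := (volume : Measure (Fin m → ℂ)))
    (p := 2) (q := 2) Real.HolderConjugate.two_two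
    (f := fun w => ‖inner ℂ f (displacement w f)‖) (g := fun w => ‖inner ℂ g (displacement w g)‖)
    (.of_forall fun _ => norm_nonneg _) (.of_forall fun _ => norm_nonneg _)
    (by rw [h2]; exact (memLp_inner_displacement f f).norm)
    (by rw [h2]; exact (memLp_inner_displacement g g).norm)
  simp only [norm_mul]
  refine h.trans (le_of_eq ?_)
  simp only [Real.rpow_ofNat]
  rw [integral_norm_sq_inner_displacement, integral_norm_sq_inner_displacement,
    ← Real.sqrt_eq_rpow, ← Real.sqrt_eq_rpow, ← Real.sqrt_mul (by positivity)]
  rw [show Real.pi ^ m * ‖f‖ ^ 4 * (Real.pi ^ m * ‖g‖ ^ 4)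
    = (Real.pi ^ m * (‖f‖ ^ 2 * ‖g‖ ^ 2)) ^ 2 by ring, Real.sqrt_sq (by positivity)]

/-- The overlap formula for the product of two pure characteristic functions. -/
theorem integral_inner_displacement_mul_exp (α : Fin m → ℂ) (v u : ModeSpace m) :
    ∫ w : Fin m → ℂ, inner ℂ v (displacement w v) * inner ℂ u (displacement w u)
        * Complex.exp (∑ j, (α j * starRingEnd ℂ (w j) - starRingEnd ℂ (α j) * w j))
      = (Real.pi : ℂ) ^ m * (inner ℂ v (displacement α (parity m u))
          * inner ℂ (displacement α (parity m u)) v) := by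
  rw [← integral_conj_inner_displacement_mul]
  refine integral_congr_ae (.of_forall fun w => ?_)
  simp only [conj_inner_displaced_parity]
  ring

end PhaseSpace

/-! ### Traces of rank-one series and decomposition of states -/

section TraceClass

open InnerProductSpace

variable {H : Type} [NormedAddCommGroup H] [InnerProductSpace ℂ H]

theorem hasSum_norm_sq_inner {ι : Type*} (b : HilbertBasis ι ℂ H) (x : H) :
    HasSum (fun i => ‖inner ℂ (b i) x‖ ^ 2) (‖x‖ ^ 2) := by
  have h := b.hasSum_inner_mul_inner x x
  rw [inner_self_eq_norm_sq_to_K] at h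
  have h1 : ∀ i, inner ℂ x (b i) * inner ℂ (b i) x = ((‖inner ℂ (b i) x‖ ^ 2 : ℝ) : ℂ) := by
    intro i
    rw [← inner_conj_symm, mul_comm, Complex.mul_conj, Complex.normSq_eq_norm_sq]
  simp only [h1] at h
  exact Complex.hasSum_ofReal.1 (by simpa using h)

theorem summable_norm_inner_mul_norm_inner {ι : Type*} (b : HilbertBasis ι ℂ H) (x y : H) :
    Summable (fun i => ‖inner ℂ (b i) x‖ * ‖inner ℂ (b i) y‖) ∧
      ∑' i, ‖inner ℂ (b i) x‖ * ‖inner ℂ (b i) y‖ ≤ ‖x‖ * ‖y‖ := by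
  have h := Real.summable_and_inner_le_Lp_mul_Lq_tsum_of_nonneg (p := 2) (q := 2)
    Real.HolderConjugate.two_two (f := fun i => ‖inner ℂ (b i) x‖) (g := fun i => ‖inner ℂ (b i) y‖)
    (fun _ => norm_nonneg _) (fun _ => norm_nonneg _)
    (by simpa only [Real.rpow_ofNat] using (hasSum_norm_sq_inner b x).summable)
    (by simpa only [Real.rpow_ofNat] using (hasSum_norm_sq_inner b y).summable)
  simp only [Real.rpow_ofNat, (hasSum_norm_sq_inner b _).tsum_eq, ← Real.sqrt_eq_rpow,
    Real.sqrt_sq (norm_nonneg _)] at h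
  exact h

/-- A norm-convergent series of rank one operators `∑ |a i⟩⟨c i|` has trace `∑ ⟨c i, a i⟩`. -/
theorem HasTrace.of_hasSum_rankOne {κ : Type*} {a c : κ → H} {T : H →L[ℂ] H}
    (hs : Summable fun i => ‖a i‖ * ‖c i‖) (hT : HasSum (fun i => rankOne ℂ (a i) (c i)) T)
    {t : ℂ} (ht : HasSum (fun i => inner ℂ (c i) (a i)) t) : HasTrace T t := by
  intro ι b
  set F : κ × ι → ℂ := fun p => inner ℂ (c p.1) (b p.2) * inner ℂ (b p.2) (a p.1) with hF
  have hn : ∀ p, ‖F p‖ = ‖inner ℂ (b p.2) (a p.1)‖ * ‖inner ℂ (b p.2) (c p.1)‖ := fun p => by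
    rw [hF, norm_mul, norm_inner_symm, mul_comm]
  -- For fixed i, Cauchy–Schwarz and Parseval bound the sum over the basis by ‖a i‖ ‖c i‖. Absolute
  -- summability of the double family then lets the two orders of summation be compared.
  have hFs : Summable F := by
    refine Summable.of_norm ?_
    simp only [hn]
    rw [summable_prod_of_nonneg fun p => by positivity]
    exact ⟨fun i => (summable_norm_inner_mul_norm_inner b (a i) (c i)).1,
      hs.of_nonneg_of_le (fun i => tsum_nonneg fun k => by positivity)
        fun i => (summable_norm_inner_mul_norm_inner b (a i) (c i)).2⟩
  have h1 : HasSum F t := by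
    have h := hFs.hasSum.prod_fiberwise fun i => b.hasSum_inner_mul_inner (c i) (a i)
    rw [ht.unique h]
    exact hFs.hasSum
  have h2 : HasSum (fun p : ι × κ => F p.swap) t :=
    (Equiv.prodComm ι κ).hasSum_iff.2 h1
  refine h2.prod_fiberwise fun k => ?_
  -- Taking a diagonal matrix element is a continuous functional of the operator, so the sum over
  -- the rank-one terms is the matrix element of `T`.
  have h3 := hT.mapL ((innerSL ℂ (b k)).comp (ContinuousLinearMap.apply ℂ H (b k)))
  simpa [hF] using h3

variable [CompleteSpace H]

theorem summable_rankOne_self {κ : Type*} {v : κ → H} (hv : Summable fun i => ‖v i‖ ^ 2) :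
    Summable fun i => rankOne ℂ (v i) (v i) := by
  refine Summable.of_norm ?_
  simpa only [norm_rankOne, ← sq] using hv

/-- A state is a countable mixture `∑ |v i⟩⟨v i|` of (unnormalised) vectors. -/
theorem IsDensityOperator.exists_hasSum_rankOne {ρ : H →L[ℂ] H} (hρ : IsDensityOperator ρ) :
    ∃ (κ : Type) (_ : Countable κ) (v : κ → H), Summable (fun i => ‖v i‖ ^ 2) ∧
      HasSum (fun i => rankOne ℂ (v i) (v i)) ρ := by
  have hρ0 : 0 ≤ ρ := (ContinuousLinearMap.nonneg_iff_isPositive ρ).2 hρ.isPositive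
  obtain ⟨s, b, -⟩ := exists_hilbertBasis ℂ H
  -- The vectors are √ρ applied to a Hilbert basis: ‖√ρ b i‖² = ⟨b i, ρ b i⟩ is summable because the
  -- trace exists, and expanding √ρ x in the basis and applying √ρ recovers ρ x.
  set A : H →L[ℂ] H := CFC.sqrt ρ with hA
  have hAA : ∀ x, A (A x) = ρ x := fun x => DFunLike.congr_fun (CFC.sqrt_mul_sqrt_self ρ hρ0) x
  have hAs : ∀ x y, inner ℂ (A x) y = inner ℂ x (A y) := fun x y =>
    ((ContinuousLinearMap.nonneg_iff_isPositive A).1 (CFC.sqrt_nonneg ρ)).isSymmetric x y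
  have hv : Summable fun i => ‖A (b i)‖ ^ 2 := by
    have h := (hρ.hasTrace_one s b).summable.norm
    refine h.congr fun i => ?_
    rw [← hAA, ← hAs, inner_self_eq_norm_sq_to_K]
    simp
  have hsum : HasSum (fun i => rankOne ℂ (A (b i)) (A (b i))) ρ := by
    obtain ⟨T, hT⟩ := summable_rankOne_self hv
    have : T = ρ := by
      ext x
      have h1 := hT.mapL (ContinuousLinearMap.apply ℂ H x)
      have h2 := (b.hasSum_repr (A x)).mapL A
      simp only [ContinuousLinearMap.apply_apply, rankOne_apply] at h1
      refine h1.unique ?_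
      rw [← hAA]
      refine h2.congr_fun fun i => ?_
      rw [map_smul, b.repr_apply_apply, hAs]
    rwa [this] at hT
  -- The Hilbert basis is not known to be countable; only countably many vectors are nonzero, and
  -- the others are discarded. Countability is needed to integrate the series.
  have hc : (Function.support fun i => ‖A (b i)‖ ^ 2).Countable := hv.countable_support
  refine ⟨_, hc.to_subtype, fun i => A (b i), hv.subtype _, ?_⟩
  refine (hasSum_subtype_iff_of_support_subset (f := fun i => rankOne ℂ (A (b i)) (A (b i)))
    fun i hi => ?_).2 hsum
  rw [Function.mem_support] at hi ⊢
  intro h0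
  exact hi (by rw [norm_eq_zero.1 (pow_eq_zero_iff two_ne_zero |>.1 h0)]; simp)

end TraceClass

open InnerProductSpace

/-! ### Partial traces of mixtures of two-mode vectors -/

section PartialTrace

/-- The bounded map `g ↦ f ⊗ g`. -/
def tensorLeft (f : ModeSpace m) : ModeSpace m →L[ℂ] TwoModeSpace m :=
  (tensorBilin m f).mkContinuous ‖f‖ fun g => (norm_tensorVec f g).le

theorem inner_adjoint_tensorRight (f g : ModeSpace m) (Ψ : TwoModeSpace m) :
    inner ℂ f (ContinuousLinearMap.adjoint (tensorRight g) Ψ) = inner ℂ (tensorVec f g) Ψ := by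
  rw [ContinuousLinearMap.adjoint_inner_right]; rfl

theorem inner_adjoint_tensorLeft (f g : ModeSpace m) (Ψ : TwoModeSpace m) :
    inner ℂ g (ContinuousLinearMap.adjoint (tensorLeft f) Ψ) = inner ℂ (tensorVec f g) Ψ := by
  rw [ContinuousLinearMap.adjoint_inner_right]; rfl

theorem eq_zero_of_forall_inner_hilbertBasis {ι : Type} (b : HilbertBasis ι ℂ (ModeSpace m))
    {x : ModeSpace m} (h : ∀ i, inner ℂ (b i) x = 0) : x = 0 := by
  have hs := hasSum_norm_sq_inner b x
  simp only [h, norm_zero, ne_eq, OfNat.ofNat_ne_zero, not_false_eq_true, zero_pow] at hs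
  exact norm_eq_zero.1 (pow_eq_zero_iff two_ne_zero |>.1 (hs.unique hasSum_zero))

/-- The product of two Hilbert bases. -/
def tensorBasis {ι κ : Type} (b : HilbertBasis ι ℂ (ModeSpace m))
    (e : HilbertBasis κ ℂ (ModeSpace m)) : HilbertBasis (ι × κ) ℂ (TwoModeSpace m) :=
  -- The first index belongs to the second set of modes, so that fiberwise sums group terms by the
  -- basis vector that the partial trace contracts with.
  HilbertBasis.mkOfOrthogonalEqBot (v := fun p : ι × κ => tensorVec (e p.2) (b p.1))
    (by
      classical
      rw [orthonormal_iff_ite]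
      rintro ⟨i, k⟩ ⟨i', k'⟩
      rw [inner_tensorVec, orthonormal_iff_ite.1 e.orthonormal, orthonormal_iff_ite.1 b.orthonormal]
      by_cases h1 : i = i' <;> by_cases h2 : k = k' <;> simp [h1, h2])
    (by
      rw [Submodule.eq_bot_iff]
      intro Ψ hΨ
      have h0 : ∀ i k, inner ℂ (tensorVec (e k) (b i)) Ψ = 0 := fun i k =>
        (Submodule.mem_orthogonal _ _).1 hΨ _ (Submodule.subset_span ⟨(i, k), rfl⟩)
      refine tensorVec_total Ψ fun f g => ?_
      have h1 : ∀ i, inner ℂ (tensorVec f (b i)) Ψ = 0 := fun i => by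
        have h : ContinuousLinearMap.adjoint (tensorRight (b i)) Ψ = 0 :=
          eq_zero_of_forall_inner_hilbertBasis e fun k => by rw [inner_adjoint_tensorRight, h0]
        rw [← inner_adjoint_tensorRight, h, inner_zero_right]
      have h : ContinuousLinearMap.adjoint (tensorLeft f) Ψ = 0 :=
        eq_zero_of_forall_inner_hilbertBasis b fun i => by rw [inner_adjoint_tensorLeft, h1]
      rw [← inner_adjoint_tensorLeft, h, inner_zero_right])

theorem tensorBasis_apply {ι κ : Type} (b : HilbertBasis ι ℂ (ModeSpace m))
    (e : HilbertBasis κ ℂ (ModeSpace m)) (p : ι × κ) :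
    tensorBasis b e p = tensorVec (e p.2) (b p.1) := by
  rw [tensorBasis, HilbertBasis.coe_mkOfOrthogonalEqBot]

/-- Parseval in a product basis, summed first over the basis of the first factor. Contracting the
second factor against a basis thus loses no inner products. -/
theorem hasSum_inner_adjoint_tensorRight {ι : Type} (b : HilbertBasis ι ℂ (ModeSpace m))
    (Ψ Φ : TwoModeSpace m) :
    HasSum (fun i => inner ℂ (ContinuousLinearMap.adjoint (tensorRight (b i)) Ψ)
      (ContinuousLinearMap.adjoint (tensorRight (b i)) Φ)) (inner ℂ Ψ Φ) := by
  obtain ⟨s, e, -⟩ := exists_hilbertBasis ℂ (ModeSpace m)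
  refine ((tensorBasis b e).hasSum_inner_mul_inner Ψ Φ).prod_fiberwise fun i => ?_
  refine (e.hasSum_inner_mul_inner _ _).congr_fun fun k => ?_
  rw [tensorBasis_apply, inner_adjoint_tensorRight, ← inner_conj_symm,
    ← inner_conj_symm _ (e k), inner_adjoint_tensorRight]

theorem hasSum_norm_sq_adjoint_tensorRight {ι : Type} (b : HilbertBasis ι ℂ (ModeSpace m))
    (Ψ : TwoModeSpace m) :
    HasSum (fun i => ‖ContinuousLinearMap.adjoint (tensorRight (b i)) Ψ‖ ^ 2) (‖Ψ‖ ^ 2) := by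
  have h := hasSum_inner_adjoint_tensorRight b Ψ Ψ
  simp only [inner_self_eq_norm_sq_to_K] at h
  exact Complex.hasSum_ofReal.1 (by simpa using h)

theorem summable_norm_sq_adjoint_tensorRight {ι κ : Type} (b : HilbertBasis ι ℂ (ModeSpace m))
    {Ψ : κ → TwoModeSpace m} (hΨ : Summable fun k => ‖Ψ k‖ ^ 2) :
    Summable fun p : κ × ι => ‖ContinuousLinearMap.adjoint (tensorRight (b p.2)) (Ψ p.1)‖ ^ 2 := by
  rw [summable_prod_of_nonneg fun p => by positivity]
  refine ⟨fun k => (hasSum_norm_sq_adjoint_tensorRight b (Ψ k)).summable, ?_⟩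
  simpa only [(hasSum_norm_sq_adjoint_tensorRight b _).tsum_eq] using hΨ

/-- The partial trace of a mixture of two-mode vectors, over a given basis. -/
theorem hasSum_partialTrace_terms {ι κ : Type} (b : HilbertBasis ι ℂ (ModeSpace m))
    {Ψ : κ → TwoModeSpace m} {T : TwoModeSpace m →L[ℂ] TwoModeSpace m}
    (hT : HasSum (fun k => rankOne ℂ (Ψ k) (Ψ k)) T) {τ : ModeSpace m →L[ℂ] ModeSpace m}
    (hτ : HasSum (fun p : κ × ι =>
      rankOne ℂ (ContinuousLinearMap.adjoint (tensorRight (b p.2)) (Ψ p.1))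
        (ContinuousLinearMap.adjoint (tensorRight (b p.2)) (Ψ p.1))) τ) :
    HasSum (fun i => ContinuousLinearMap.adjoint (tensorRight (b i)) ∘L T ∘L tensorRight (b i))
      τ := by
  refine ((Equiv.prodComm ι κ).hasSum_iff.2 hτ).prod_fiberwise fun i => ?_
  have h := (hT.mapL ((ContinuousLinearMap.compL ℂ (ModeSpace m) (TwoModeSpace m)
    (TwoModeSpace m)).flip (tensorRight (b i)))).mapL
    (ContinuousLinearMap.compL ℂ (ModeSpace m) (TwoModeSpace m) (ModeSpace m)
      (ContinuousLinearMap.adjoint (tensorRight (b i))))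
  refine h.congr_fun fun k => ?_
  simp only [ContinuousLinearMap.flip_apply, ContinuousLinearMap.compL_apply, rankOne_comp,
    comp_rankOne, Function.comp_apply, Equiv.prodComm_apply, Prod.swap_prod_mk]

/-- The other contraction, `tensorLeft`, gives matrix elements of τ in which `b` no longer appears,
by Parseval in the second factor. This yields basis independence of the partial trace. -/
theorem inner_partialTrace {ι κ : Type} (b : HilbertBasis ι ℂ (ModeSpace m))
    {Ψ : κ → TwoModeSpace m} {τ : ModeSpace m →L[ℂ] ModeSpace m}
    (hτ : HasSum (fun p : κ × ι =>
      rankOne ℂ (ContinuousLinearMap.adjoint (tensorRight (b p.2)) (Ψ p.1))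
        (ContinuousLinearMap.adjoint (tensorRight (b p.2)) (Ψ p.1))) τ) (x y : ModeSpace m) :
    HasSum (fun k => inner ℂ (ContinuousLinearMap.adjoint (tensorLeft y) (Ψ k))
      (ContinuousLinearMap.adjoint (tensorLeft x) (Ψ k))) (inner ℂ x (τ y)) := by
  have h := hτ.mapL ((innerSL ℂ x).comp (ContinuousLinearMap.apply ℂ (ModeSpace m) y))
  refine h.prod_fiberwise fun k => ?_
  refine (b.hasSum_inner_mul_inner _ _).congr_fun fun i => ?_
  simp only [ContinuousLinearMap.comp_apply, ContinuousLinearMap.apply_apply, rankOne_apply,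
    innerSL_apply_apply, inner_smul_right, inner_adjoint_tensorLeft, inner_adjoint_tensorRight]
  rw [← inner_conj_symm, inner_adjoint_tensorRight, ← inner_conj_symm _ (b i),
    inner_adjoint_tensorLeft]

/-- A mixture of two-mode vectors has a partial trace, and the trace of the partial trace against an
operator `D` is computed by any vectors `Φ k = (D ⊗ 1) Ψ k`. -/
theorem exists_hasPartialTrace {κ : Type} {Ψ : κ → TwoModeSpace m}
    {T : TwoModeSpace m →L[ℂ] TwoModeSpace m} (hΨ : Summable fun k => ‖Ψ k‖ ^ 2)
    (hT : HasSum (fun k => rankOne ℂ (Ψ k) (Ψ k)) T) :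
    ∃ τ, HasPartialTrace T τ ∧ ∀ (D : ModeSpace m →L[ℂ] ModeSpace m) (Φ : κ → TwoModeSpace m),
      (∀ g k, ContinuousLinearMap.adjoint (tensorRight g) (Φ k)
        = D (ContinuousLinearMap.adjoint (tensorRight g) (Ψ k))) →
      HasTrace (τ ∘L D) (∑' k, inner ℂ (Ψ k) (Φ k)) := by
  obtain ⟨s, b, -⟩ := exists_hilbertBasis ℂ (ModeSpace m)
  have hY := summable_norm_sq_adjoint_tensorRight b hΨ
  obtain ⟨τ, hτ⟩ := summable_rankOne_self hY
  refine ⟨τ, fun ι b' => ?_, fun D Φ hΦ => ?_⟩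
  · obtain ⟨τ', hτ'⟩ := summable_rankOne_self (summable_norm_sq_adjoint_tensorRight b' hΨ)
    have : τ' = τ := by
      ext1 y
      exact ext_inner_left ℂ fun x =>
        (inner_partialTrace b' hτ' x y).unique (inner_partialTrace b hτ x y)
    exact hasSum_partialTrace_terms b' hT (this ▸ hτ')
  · set Y : κ × s → ModeSpace m :=
      fun p => ContinuousLinearMap.adjoint (tensorRight (b p.2)) (Ψ p.1) with hYdef
    have h1 := hτ.mapL ((ContinuousLinearMap.compL ℂ (ModeSpace m) (ModeSpace m)
      (ModeSpace m)).flip D)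
    simp only [ContinuousLinearMap.flip_apply, ContinuousLinearMap.compL_apply, rankOne_comp] at h1
    -- Composing with D turns |Y⟩⟨Y| into |Y⟩⟨D†Y|, whose trace is ⟨D†Y, Y⟩ = ⟨Y, D Y⟩.
    have hD : ∀ p, inner ℂ (ContinuousLinearMap.adjoint D (Y p)) (Y p) = inner ℂ (Y p) (D (Y p)) :=
      fun p => ContinuousLinearMap.adjoint_inner_left _ _ _
    have hs : Summable fun p => inner ℂ (ContinuousLinearMap.adjoint D (Y p)) (Y p) := by
      refine (hY.mul_left ‖D‖).of_norm_bounded fun p => ?_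
      rw [hD]
      refine (norm_inner_le_norm _ _).trans ?_
      have := mul_le_mul_of_nonneg_left (D.le_opNorm (Y p)) (norm_nonneg (Y p))
      linarith [this, sq ‖Y p‖, mul_left_comm ‖Y p‖ ‖D‖ ‖Y p‖]
    refine HasTrace.of_hasSum_rankOne ?_ h1 ?_
    · refine (hY.mul_left ‖ContinuousLinearMap.adjoint D‖).of_nonneg_of_le
        (fun p => by positivity) fun p => ?_
      have := mul_le_mul_of_nonneg_left
        ((ContinuousLinearMap.adjoint D).le_opNorm (Y p)) (norm_nonneg (Y p))
      linarith [this, sq ‖Y p‖, mul_left_comm ‖Y p‖ ‖ContinuousLinearMap.adjoint D‖ ‖Y p‖]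
    -- For fixed k, the hypothesis on Φ replaces D applied to a contraction of Ψ k by a contraction
    -- of Φ k, and Parseval sums these to ⟨Ψ k, Φ k⟩.
    · have h2 := hs.hasSum.prod_fiberwise fun k => by
        simp only [hD]
        refine (hasSum_inner_adjoint_tensorRight b (Ψ k) (Φ k)).congr_fun fun i => ?_
        rw [hΦ]
      rw [h2.tsum_eq]
      exact hs.hasSum

end PartialTrace

/-! ### Product mixtures and the 50:50 beam splitter -/

section BeamSplitter

/-- The double series converges absolutely in norm. Its sum acts on f ⊗ g by factoring into the two
single series, and `eq_tensorOp` identifies an operator from product vectors. -/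
theorem hasSum_rankOne_tensorOp {ι κ : Type} {v : ι → ModeSpace m} {u : κ → ModeSpace m}
    {ρ σ : ModeSpace m →L[ℂ] ModeSpace m} (hv : Summable fun i => ‖v i‖ ^ 2)
    (hu : Summable fun j => ‖u j‖ ^ 2) (hρ : HasSum (fun i => rankOne ℂ (v i) (v i)) ρ)
    (hσ : HasSum (fun j => rankOne ℂ (u j) (u j)) σ) :
    HasSum (fun p : ι × κ => rankOne ℂ (tensorVec (v p.1) (u p.2)) (tensorVec (v p.1) (u p.2)))
      (tensorOp ρ σ) := by
  have hs : Summable fun p : ι × κ => ‖tensorVec (v p.1) (u p.2)‖ ^ 2 := by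
    simp only [norm_tensorVec, mul_pow]
    exact hv.mul_of_nonneg hu (fun _ => by positivity) fun _ => by positivity
  obtain ⟨T, hT⟩ := summable_rankOne_self hs
  have : T = tensorOp ρ σ := by
    refine eq_tensorOp _ _ _ fun f g => ?_
    have h := hT.mapL (ContinuousLinearMap.apply ℂ (TwoModeSpace m) (tensorVec f g))
    simp only [ContinuousLinearMap.apply_apply, rankOne_apply] at h
    have h1 := (hρ.mapL (ContinuousLinearMap.apply ℂ (ModeSpace m) f)).mapL (tensorRight (σ g))
    have h2 := hσ.mapL (ContinuousLinearMap.apply ℂ (ModeSpace m) g)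
    simp only [ContinuousLinearMap.apply_apply, rankOne_apply] at h1 h2
    refine HasSum.unique (h.prod_fiberwise fun i => ?_) h1
    refine (h2.mapL (tensorLeft (inner ℂ (v i) f • v i))).congr_fun fun j => ?_
    have : tensorBilin m (inner ℂ (v i) f • v i) (inner ℂ (u j) g • u j)
        = inner ℂ (tensorVec (v i) (u j)) (tensorVec f g) • tensorVec (v i) (u j) := by
      rw [map_smul, map_smul, LinearMap.smul_apply, smul_smul, inner_tensorVec, mul_comm]
      rfl
    exact this.symm
  rwa [this] at hT

theorem norm_beamSplitter_apply (t : ℝ) (F : TwoModeSpace m) : ‖beamSplitter m t F‖ = ‖F‖ :=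
  (Lp.compMeasurePreservingₗᵢ ℂ (rotate _) (measurePreserving_rotate _)).norm_map F

theorem inner_beamSplitter (t : ℝ) (F G : TwoModeSpace m) :
    inner ℂ (beamSplitter m t F) (beamSplitter m t G) = inner ℂ F G :=
  (Lp.compMeasurePreservingₗᵢ ℂ (rotate _) (measurePreserving_rotate _)).inner_map_map F G

theorem beamSplitter_coeFn (t : ℝ) (F : TwoModeSpace m) :
    beamSplitter m t F =ᵐ[volume] fun p => F (rotate (Real.arccos √t) p) :=
  Lp.coeFn_compMeasurePreserving F (measurePreserving_rotate _)

theorem rotate_arccos_sqrt_half (p : Pos m × Pos m) :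
    rotate (Real.arccos √(1 / 2)) p
      = ((√2)⁻¹ • p.1 - (√2)⁻¹ • p.2, (√2)⁻¹ • p.1 + (√2)⁻¹ • p.2) := by
  have h1 : √(1 / 2 : ℝ) ≤ 1 := Real.sqrt_le_one.2 (by norm_num)
  have h0 : (0 : ℝ) ≤ √(1 / 2) := Real.sqrt_nonneg _
  have h2 : √(1 / 2 : ℝ) = (√2)⁻¹ := by rw [one_div, Real.sqrt_inv]
  have hs : √(1 - √(1 / 2 : ℝ) ^ 2) = (√2)⁻¹ := by
    rw [Real.sq_sqrt (by norm_num), ← h2]; norm_num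
  rw [rotate, Real.cos_arccos (by linarith) h1, Real.sin_arccos, hs, h2]

end BeamSplitter

/-! ### Displacements through the beam splitter -/

section BeamSplitterDisplacement

theorem isAddRightInvariant_volume_prod :
    (volume : Measure (Pos m × Pos m)).IsAddRightInvariant := by
  rw [Measure.volume_eq_prod]; infer_instance

/-- The contributions of y cancel between the two outputs of the rotation and those of x add up; the
two quadratic terms are each half of the one for z. -/
theorem dispPhase_beamSplitter (z : Fin m → ℂ) (x y : Pos m) :
    dispPhase ((√2)⁻¹ • z) ((√2)⁻¹ • x - (√2)⁻¹ • y)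
      * dispPhase ((√2)⁻¹ • z) ((√2)⁻¹ • x + (√2)⁻¹ • y) = dispPhase z x := by
  have h2 : (√2)⁻¹ * (√2)⁻¹ = 1 / 2 := by
    rw [← mul_inv, Real.mul_self_sqrt zero_le_two, one_div]
  have h3 : √2 * (√2)⁻¹ = 1 := mul_inv_cancel₀ (by positivity)
  rw [dispPhase, dispPhase, dispPhase, ← Complex.exp_add, ← mul_add, ← Complex.ofReal_add]
  congr 3
  simp only [rePart_smul, imPart_smul, inner_add_right, inner_sub_right, inner_smul_right,
    inner_smul_left, conj_trivial]
  linear_combination (2 * √2 * inner ℝ (imPart z) x - 2 * inner ℝ (imPart z) (rePart z)) * h2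

/-- The two-mode displacement `D(z) ⊗ 1` on the output is `D(z/√2) ⊗ D(z/√2)` on the input. -/
theorem beamSplitter_displacement_coeFn (z : Fin m → ℂ) (f g : ModeSpace m) :
    beamSplitter m (1 / 2) (tensorVec (displacement ((√2)⁻¹ • z) f) (displacement ((√2)⁻¹ • z) g))
      =ᵐ[volume] fun p => dispPhase z p.1
        * beamSplitter m (1 / 2) (tensorVec f g) (p - (√2 • rePart z, 0)) := by
  set w : Fin m → ℂ := (√2)⁻¹ • z with hw
  have hR := measurePreserving_rotate (m := m) (Real.arccos √(1 / 2))
  have := isAddRightInvariant_volume_prod (m := m)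
  have hS : MeasurePreserving (fun p : Pos m × Pos m => p - (√2 • rePart z, 0)) volume volume :=
    measurePreserving_sub_right volume _
  filter_upwards [beamSplitter_coeFn (1 / 2) (tensorVec (displacement w f) (displacement w g)),
    hR.quasiMeasurePreserving.ae (tensorVec_coeFn (displacement w f) (displacement w g)),
    hR.quasiMeasurePreserving.ae (aeFst (displacement_coeFn w f)),
    hR.quasiMeasurePreserving.ae (aeSnd (displacement_coeFn w g)),
    hS.quasiMeasurePreserving.ae (beamSplitter_coeFn (1 / 2) (tensorVec f g)),
    (hR.comp hS).quasiMeasurePreserving.ae (tensorVec_coeFn f g)] with p h1 h2 h3 h4 h5 h6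
  rw [Function.comp_apply] at h6
  rw [h1, h2, h3, h4, h5, h6, dispFun, dispFun, rotate_arccos_sqrt_half, rotate_arccos_sqrt_half,
    ← dispPhase_beamSplitter z p.1 p.2, ← hw]
  -- The translation (√2 Re z, 0) is rotated to (Re z, Re z), which is the translation of D(z/√2) in
  -- each factor.
  have h7 : √2 • rePart w = rePart z := by
    rw [hw, rePart_smul, smul_smul, mul_inv_cancel₀ (by positivity), one_smul]
  have h8 : (√2)⁻¹ • √2 • rePart z = rePart z := by
    rw [smul_smul, inv_mul_cancel₀ (by positivity), one_smul]
  simp only [Prod.fst_sub, Prod.snd_sub, sub_zero, h7, smul_sub, h8]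
  rw [sub_right_comm ((√2)⁻¹ • p.1) (rePart z), sub_add_eq_add_sub ((√2)⁻¹ • p.1) (rePart z)]
  ring

/-- Pointwise form of D(-z)† = D(z), as it appears after a translation of the integration variable.
-/
theorem conj_dispPhase_neg_shift (z : Fin m → ℂ) (x : Pos m) :
    starRingEnd ℂ (dispPhase (-z) (x - √2 • rePart z)) = dispPhase z x := by
  have hr : rePart (-z) = -rePart z := by ext j; simp [rePart]
  have hi : imPart (-z) = -imPart z := by ext j; simp [imPart]
  rw [dispPhase, dispPhase, ← Complex.exp_conj, map_mul, Complex.conj_I, Complex.conj_ofReal, hr,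
    hi, neg_mul, ← mul_neg, ← Complex.ofReal_neg]
  congr 3
  simp only [inner_neg_left, inner_neg_right, inner_sub_right, inner_smul_right]
  linear_combination (-inner ℝ (imPart z) (rePart z)) * Real.mul_self_sqrt zero_le_two

/-- Supplies the hypothesis on Φ in `exists_hasPartialTrace` with D = D(z). Testing against x ⊗ h
moves D(z) onto x as D(-z), and translating the first variable by √2 Re z matches the two integrals.
-/
theorem adjoint_tensorRight_beamSplitter_displacement (z : Fin m → ℂ) (f g h : ModeSpace m) :
    ContinuousLinearMap.adjoint (tensorRight h) (beamSplitter m (1 / 2)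
        (tensorVec (displacement ((√2)⁻¹ • z) f) (displacement ((√2)⁻¹ • z) g)))
      = displacement z (ContinuousLinearMap.adjoint (tensorRight h)
          (beamSplitter m (1 / 2) (tensorVec f g))) := by
  refine ext_inner_left ℂ fun x => ?_
  have hz : displacement z = ContinuousLinearMap.adjoint (displacement (-z)) := by
    rw [adjoint_displacement, neg_neg]
  rw [inner_adjoint_tensorRight, hz, ContinuousLinearMap.adjoint_inner_right,
    inner_adjoint_tensorRight, L2.inner_def, L2.inner_def]
  have := isAddRightInvariant_volume_prod (m := m)
  have hS : MeasurePreserving (fun p : Pos m × Pos m => p - (√2 • rePart z, 0)) volume volume :=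
    measurePreserving_sub_right volume _
  refine Eq.trans (integral_congr_ae ?_) (integral_sub_right_eq_self
    (μ := (volume : Measure (Pos m × Pos m)))
    (fun p => inner ℂ (tensorVec (displacement (-z) x) h p)
      (beamSplitter m (1 / 2) (tensorVec f g) p)) (√2 • rePart z, 0))
  have hr : rePart (-z) = -rePart z := by ext j; simp [rePart]
  filter_upwards [beamSplitter_displacement_coeFn z f g, tensorVec_coeFn x h,
    hS.quasiMeasurePreserving.ae (tensorVec_coeFn (displacement (-z) x) h),
    hS.quasiMeasurePreserving.ae (aeFst (displacement_coeFn (-z) x))] with p h1 h2 h3 h4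
  rw [RCLike.inner_apply, RCLike.inner_apply, h1, h2, h3, h4, dispFun, hr]
  simp only [Prod.fst_sub, Prod.snd_sub, sub_zero, smul_neg, sub_neg_eq_add, sub_add_cancel,
    map_mul, conj_dispPhase_neg_shift]
  ring

end BeamSplitterDisplacement

/-! ### The characteristic function of a convolution -/

section CharacteristicFunction

/-- The convolution of two mixtures and its characteristic function. -/
theorem quantumCharFun_quantumConv {ι κ : Type} {v : ι → ModeSpace m} {u : κ → ModeSpace m}
    {ρ σ : ModeSpace m →L[ℂ] ModeSpace m} (hv : Summable fun i => ‖v i‖ ^ 2)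
    (hu : Summable fun j => ‖u j‖ ^ 2) (hρ : HasSum (fun i => rankOne ℂ (v i) (v i)) ρ)
    (hσ : HasSum (fun j => rankOne ℂ (u j) (u j)) σ) (z : Fin m → ℂ) :
    quantumCharFun (quantumConv (1 / 2) ρ σ) z
      = ∑' p : ι × κ, inner ℂ (v p.1) (displacement ((√2)⁻¹ • z) (v p.1))
          * inner ℂ (u p.2) (displacement ((√2)⁻¹ • z) (u p.2)) := by
  set U := beamSplitter m (1 / 2) with hU
  have hT := ((hasSum_rankOne_tensorOp hv hu hρ hσ).mapL ((ContinuousLinearMap.compL ℂ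
    (TwoModeSpace m) (TwoModeSpace m) (TwoModeSpace m)).flip (ContinuousLinearMap.adjoint U))).mapL
    (ContinuousLinearMap.compL ℂ (TwoModeSpace m) (TwoModeSpace m) (TwoModeSpace m) U)
  simp only [ContinuousLinearMap.flip_apply, ContinuousLinearMap.compL_apply, rankOne_comp,
    comp_rankOne, ContinuousLinearMap.adjoint_adjoint] at hT
  have hs : Summable fun p : ι × κ => ‖U (tensorVec (v p.1) (u p.2))‖ ^ 2 := by
    simp only [hU, norm_beamSplitter_apply, norm_tensorVec, mul_pow]
    exact hv.mul_of_nonneg hu (fun _ => by positivity) fun _ => by positivity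
  obtain ⟨τ, hτ, htr⟩ := exists_hasPartialTrace hs hT
  -- The displaced vectors are again in the image of the isometry U, so U cancels in the inner
  -- products and each term factors over the two inputs.
  have h := htr (displacement z) (fun p => U (tensorVec (displacement ((√2)⁻¹ • z) (v p.1))
    (displacement ((√2)⁻¹ • z) (u p.2)))) fun g p =>
      adjoint_tensorRight_beamSplitter_displacement z _ _ g
  rw [quantumCharFun, quantumConv, hτ.partialTrace_eq, h.trace_eq]
  simp only [hU, inner_beamSplitter, inner_tensorVec]

end CharacteristicFunction

/-- Pointwise summability makes the sum a limit of finite partial sums, hence measurable (the filter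
of finite subsets is countably generated); the L¹ bound is Tonelli. -/
theorem integrable_tsum_of_summable_integral_norm {α ι : Type*} [MeasurableSpace α]
    {μ : Measure α} [Countable ι] {F : ι → α → ℂ} (hF : ∀ i, Integrable (F i) μ)
    (hp : ∀ a, Summable fun i => F i a) (hs : Summable fun i => ∫ a, ‖F i a‖ ∂μ) :
    Integrable (fun a => ∑' i, F i a) μ := by
  constructor
  · exact aestronglyMeasurable_of_tendsto_ae Filter.atTop
      (f := fun (s : Finset ι) a => ∑ i ∈ s, F i a)
      (fun s => Finset.aestronglyMeasurable_fun_sum s fun i _ => (hF i).1)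
      (.of_forall fun a => (hp a).hasSum)
  · refine (lintegral_mono fun a => enorm_tsum_le_tsum_enorm).trans_lt ?_
    rw [lintegral_tsum fun i => (hF i).1.enorm]
    simp only [← ofReal_integral_norm_eq_lintegral_enorm (hF _)]
    rw [← ENNReal.ofReal_tsum_of_nonneg (fun i => integral_nonneg fun a => norm_nonneg _) hs]
    exact ENNReal.ofReal_lt_top

/-! ### Summation over mixtures and the Wigner function -/

section Mixtures

variable {ι κ : Type} {v : ι → ModeSpace m} {u : κ → ModeSpace m}

theorem norm_inner_displacement_le (f : ModeSpace m) (w : Fin m → ℂ) :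
    ‖inner ℂ f (displacement w f)‖ ≤ ‖f‖ ^ 2 := by
  refine (norm_inner_le_norm _ _).trans ?_
  rw [norm_displacement_apply, sq]

theorem summable_norm_sq_mul (hv : Summable fun i => ‖v i‖ ^ 2)
    (hu : Summable fun j => ‖u j‖ ^ 2) :
    Summable fun p : ι × κ => ‖v p.1‖ ^ 2 * ‖u p.2‖ ^ 2 :=
  hv.mul_of_nonneg hu (fun _ => by positivity) fun _ => by positivity

theorem summable_inner_displacement_mul (hv : Summable fun i => ‖v i‖ ^ 2)
    (hu : Summable fun j => ‖u j‖ ^ 2) (w : Fin m → ℂ) :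
    Summable fun p : ι × κ => inner ℂ (v p.1) (displacement w (v p.1))
      * inner ℂ (u p.2) (displacement w (u p.2)) := by
  refine (summable_norm_sq_mul hv hu).of_norm_bounded fun p => ?_
  rw [norm_mul]
  exact mul_le_mul (norm_inner_displacement_le _ _) (norm_inner_displacement_le _ _)
    (norm_nonneg _) (by positivity)

theorem summable_integral_norm_inner_displacement_mul (hv : Summable fun i => ‖v i‖ ^ 2)
    (hu : Summable fun j => ‖u j‖ ^ 2) :
    Summable fun p : ι × κ => ∫ w : Fin m → ℂ, ‖inner ℂ (v p.1) (displacement w (v p.1))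
      * inner ℂ (u p.2) (displacement w (u p.2))‖ :=
  ((summable_norm_sq_mul hv hu).mul_left (Real.pi ^ m)).of_nonneg_of_le
    (fun _ => integral_nonneg fun _ => norm_nonneg _)
    fun _ => integral_norm_inner_displacement_mul_le _ _

theorem integrable_tsum_inner_displacement_mul [Countable ι] [Countable κ]
    (hv : Summable fun i => ‖v i‖ ^ 2) (hu : Summable fun j => ‖u j‖ ^ 2) :
    Integrable fun w : Fin m → ℂ => ∑' p : ι × κ, inner ℂ (v p.1) (displacement w (v p.1))
      * inner ℂ (u p.2) (displacement w (u p.2)) :=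
  integrable_tsum_of_summable_integral_norm (fun _ => integrable_inner_displacement_mul _ _)
    (summable_inner_displacement_mul hv hu) (summable_integral_norm_inner_displacement_mul hv hu)

theorem norm_exp_symplectic (α w : Fin m → ℂ) :
    ‖Complex.exp (∑ j, (α j * starRingEnd ℂ (w j) - starRingEnd ℂ (α j) * w j))‖ = 1 := by
  rw [sum_symplectic, mul_comm]
  exact Complex.norm_exp_ofReal_mul_I _

theorem continuous_exp_symplectic (α : Fin m → ℂ) : Continuous fun w : Fin m → ℂ =>
    Complex.exp (∑ j, (α j * starRingEnd ℂ (w j) - starRingEnd ℂ (α j) * w j)) := by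
  have h : ∀ j, Continuous fun w : Fin m → ℂ => starRingEnd ℂ (w j) := fun j =>
    Complex.continuous_conj.comp (continuous_apply j)
  exact Complex.continuous_exp.comp (continuous_finsetSum _ fun j _ =>
    (continuous_const.mul (h j)).sub (continuous_const.mul (continuous_apply j)))

/-- The Hilbert-Schmidt overlap of a mixture with a displaced and reflected mixture. -/
def overlapSum (v : ι → ModeSpace m) (u : κ → ModeSpace m) (α : Fin m → ℂ) : ℝ :=
  ∑' p : ι × κ, ‖inner ℂ (v p.1) (displacement α (parity m (u p.2)))‖ ^ 2

theorem norm_displaced_parity (α : Fin m → ℂ) (f : ModeSpace m) :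
    ‖displacement α (parity m f)‖ = ‖f‖ := by
  rw [norm_displacement_apply, norm_parity_apply]

theorem hasSum_overlapSum (hv : Summable fun i => ‖v i‖ ^ 2)
    (hu : Summable fun j => ‖u j‖ ^ 2) (α : Fin m → ℂ) :
    HasSum (fun p : ι × κ => inner ℂ (v p.1) (displacement α (parity m (u p.2)))
      * inner ℂ (displacement α (parity m (u p.2))) (v p.1)) (overlapSum v u α : ℂ) := by
  have hs : Summable fun p : ι × κ =>
      ‖inner ℂ (v p.1) (displacement α (parity m (u p.2)))‖ ^ 2 := by
    refine (summable_norm_sq_mul hv hu).of_nonneg_of_le (fun _ => by positivity) fun p => ?_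
    rw [← mul_pow]
    refine pow_le_pow_left₀ (norm_nonneg _) ((norm_inner_le_norm _ _).trans_eq ?_) 2
    rw [norm_displaced_parity]
  refine (Complex.hasSum_ofReal.2 hs.hasSum).congr_fun fun p => ?_
  rw [← inner_conj_symm _ (v p.1), Complex.mul_conj, Complex.normSq_eq_norm_sq]

/-- The unimodular exponential leaves the L¹ norms of the terms unchanged, so the series may be
integrated term by term and the overlap formula applied to each pair. -/
theorem integral_tsum_inner_displacement_mul_exp [Countable ι] [Countable κ]
    (hv : Summable fun i => ‖v i‖ ^ 2) (hu : Summable fun j => ‖u j‖ ^ 2) (α : Fin m → ℂ) :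
    ∫ w : Fin m → ℂ, (∑' p : ι × κ, inner ℂ (v p.1) (displacement w (v p.1))
        * inner ℂ (u p.2) (displacement w (u p.2)))
        * Complex.exp (∑ j, (α j * starRingEnd ℂ (w j) - starRingEnd ℂ (α j) * w j))
      = (Real.pi : ℂ) ^ m * overlapSum v u α := by
  simp only [← tsum_mul_right]
  rw [← integral_tsum_of_summable_integral_norm]
  · simp only [integral_inner_displacement_mul_exp]
    exact ((hasSum_overlapSum hv hu α).mul_left _).tsum_eq
  · intro p
    exact (integrable_inner_displacement_mul _ _).mul_bdd (c := 1)
      (continuous_exp_symplectic α).aestronglyMeasurable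
      (.of_forall fun w => (norm_exp_symplectic α w).le)
  · simpa only [norm_mul, norm_exp_symplectic, mul_one] using
      summable_integral_norm_inner_displacement_mul hv hu

/-- With B = D(α)J, whose adjoint is J D(α)†, the operator is ρτ for τ = BσB†. Its rank-one terms |v
i⟩⟨τ†v i| have traces ⟨v i, BσB† v i⟩, and expanding σ gives ∑ⱼ |⟨v i, B u j⟩|². -/
theorem hasTrace_overlap {ρ σ : ModeSpace m →L[ℂ] ModeSpace m}
    (hv : Summable fun i => ‖v i‖ ^ 2) (hu : Summable fun j => ‖u j‖ ^ 2)
    (hρ : HasSum (fun i => rankOne ℂ (v i) (v i)) ρ)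
    (hσ : HasSum (fun j => rankOne ℂ (u j) (u j)) σ) (α : Fin m → ℂ) :
    HasTrace (ρ ∘L displacement α ∘L parity m ∘L σ ∘L parity m ∘L
      ContinuousLinearMap.adjoint (displacement α)) (overlapSum v u α) := by
  set B : ModeSpace m →L[ℂ] ModeSpace m := displacement α ∘L parity m with hB
  set τ : ModeSpace m →L[ℂ] ModeSpace m := B ∘L σ ∘L ContinuousLinearMap.adjoint B with hτdef
  have hadj : ContinuousLinearMap.adjoint B
      = parity m ∘L ContinuousLinearMap.adjoint (displacement α) := by
    rw [hB, ContinuousLinearMap.adjoint_comp, adjoint_parity]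
  have hop : ρ ∘L displacement α ∘L parity m ∘L σ ∘L parity m ∘L
      ContinuousLinearMap.adjoint (displacement α) = ρ ∘L τ := by
    rw [hτdef, hadj]; rfl
  rw [hop]
  have h1 := hρ.mapL ((ContinuousLinearMap.compL ℂ (ModeSpace m) (ModeSpace m)
    (ModeSpace m)).flip τ)
  simp only [ContinuousLinearMap.flip_apply, ContinuousLinearMap.compL_apply, rankOne_comp] at h1
  refine HasTrace.of_hasSum_rankOne ?_ h1 ?_
  · refine (hv.mul_left ‖ContinuousLinearMap.adjoint τ‖).of_nonneg_of_le
        (fun p => by positivity) fun i => ?_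
    have := mul_le_mul_of_nonneg_left
      ((ContinuousLinearMap.adjoint τ).le_opNorm (v i)) (norm_nonneg (v i))
    linarith [this, sq ‖v i‖, mul_left_comm ‖v i‖ ‖ContinuousLinearMap.adjoint τ‖ ‖v i‖]
  · refine (hasSum_overlapSum hv hu α).prod_fiberwise fun i => ?_
    have h2 := hσ.mapL ((innerSL ℂ (v i)).comp (B.comp (ContinuousLinearMap.apply ℂ (ModeSpace m)
      (ContinuousLinearMap.adjoint B (v i)))))
    have h3 : inner ℂ (ContinuousLinearMap.adjoint τ (v i)) (v i) = inner ℂ (v i)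
        (B (σ (ContinuousLinearMap.adjoint B (v i)))) := by
      rw [ContinuousLinearMap.adjoint_inner_left]; rfl
    rw [h3]
    refine h2.congr_fun fun j => ?_
    simp only [ContinuousLinearMap.comp_apply, ContinuousLinearMap.apply_apply, rankOne_apply,
      innerSL_apply_apply, map_smul, ContinuousLinearMap.adjoint_inner_right, hB]
    exact mul_comm _ _

theorem integrable_quantumCharFun_quantumConv [Countable ι] [Countable κ]
    {ρ σ : ModeSpace m →L[ℂ] ModeSpace m}
    (hv : Summable fun i => ‖v i‖ ^ 2) (hu : Summable fun j => ‖u j‖ ^ 2)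
    (hρ : HasSum (fun i => rankOne ℂ (v i) (v i)) ρ)
    (hσ : HasSum (fun j => rankOne ℂ (u j) (u j)) σ) :
    Integrable (quantumCharFun (quantumConv (1 / 2) ρ σ)) := by
  rw [funext (quantumCharFun_quantumConv hv hu hρ hσ)]
  exact (integrable_comp_smul_iff volume _ (by positivity : (√2)⁻¹ ≠ 0)).2
    (integrable_tsum_inner_displacement_mul hv hu)

theorem wigner_quantumConv [Countable ι] [Countable κ]
    {ρ σ : ModeSpace m →L[ℂ] ModeSpace m}
    (hv : Summable fun i => ‖v i‖ ^ 2) (hu : Summable fun j => ‖u j‖ ^ 2)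
    (hρ : HasSum (fun i => rankOne ℂ (v i) (v i)) ρ)
    (hσ : HasSum (fun j => rankOne ℂ (u j) (u j)) σ) (z : Fin m → ℂ) :
    wigner (quantumConv (1 / 2) ρ σ) z
      = 2 ^ m / (Real.pi : ℂ) ^ m * overlapSum v u (√2 • z) := by
  set G : (Fin m → ℂ) → ℂ := fun w => (∑' p : ι × κ, inner ℂ (v p.1) (displacement w (v p.1))
        * inner ℂ (u p.2) (displacement w (u p.2)))
        * Complex.exp (∑ j, ((√2 • z) j * starRingEnd ℂ (w j)
          - starRingEnd ℂ ((√2 • z) j) * w j)) with hG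
  have hw : ∀ w : Fin m → ℂ, quantumCharFun (quantumConv (1 / 2) ρ σ) w / (Real.pi : ℂ) ^ (2 * m) *
      Complex.exp (∑ j, (z j * starRingEnd ℂ (w j) - starRingEnd ℂ (z j) * w j))
      = ((Real.pi : ℂ) ^ (2 * m))⁻¹ * G ((√2)⁻¹ • w) := by
    intro w
    -- The symplectic form is real bilinear, so scaling one argument by √2 and the other by its
    -- inverse changes nothing. This moves the factor √2 onto z.
    have he : ∑ j, ((√2 • z) j * starRingEnd ℂ (((√2)⁻¹ • w) j)
        - starRingEnd ℂ ((√2 • z) j) * ((√2)⁻¹ • w) j)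
        = ∑ j, (z j * starRingEnd ℂ (w j) - starRingEnd ℂ (z j) * w j) := by
      refine Finset.sum_congr rfl fun j _ => ?_
      have h2 : ((√2 : ℝ) : ℂ) * ((√2 : ℝ) : ℂ)⁻¹ = 1 := mul_inv_cancel₀ (by simp)
      simp only [Pi.smul_apply, Complex.real_smul, map_mul, Complex.conj_ofReal,
        Complex.ofReal_inv, map_inv₀]
      linear_combination (z j * starRingEnd ℂ (w j) - starRingEnd ℂ (z j) * w j) * h2
    rw [quantumCharFun_quantumConv hv hu hρ hσ, hG]
    simp only [he]
    ring
  have hfin : Module.finrank ℝ (Fin m → ℂ) = 2 * m := by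
    rw [Module.finrank_pi_fintype]; simp [mul_comm]
  -- The Jacobian is taken in real dimension 2m, giving 2^m; with π^(-2m) from the definition and
  -- π^m from Moyal's identity the constant becomes (2/π)^m.
  have hscale : |(((√2)⁻¹ : ℝ) ^ (2 * m))⁻¹| = 2 ^ m := by
    rw [inv_pow, inv_inv, pow_mul, Real.sq_sqrt zero_le_two, abs_of_pos (by positivity)]
  rw [wigner]
  simp only [hw]
  rw [integral_const_mul, Measure.integral_comp_smul, hfin, hscale, hG,
    integral_tsum_inner_displacement_mul_exp hv hu, Complex.real_smul]
  have hpi : (Real.pi : ℂ) ≠ 0 := by exact_mod_cast Real.pi_ne_zero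
  push_cast
  field_simp
  ring

end Mixtures

end CV

end

/-- For `m`-mode states `ρ`, `σ`, the characteristic function of `ρ ⊞ σ` is integrable and the Wigner
function of `ρ ⊞ σ` at `z` is `(2/π)ᵐ Tr [ρ D(√2 z) J σ J D(√2 z)†]`, where the trace is well
defined; in particular the Wigner function is real and nonnegative. -/
theorem mainTheorem10 (m : ℕ) (ρ σ : CV.ModeSpace m →L[ℂ] CV.ModeSpace m)
    (hρ : CV.IsDensityOperator ρ) (hσ : CV.IsDensityOperator σ) :
    MeasureTheory.Integrable (CV.quantumCharFun (CV.quantumConv (1 / 2) ρ σ))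
      (MeasureTheory.volume : MeasureTheory.Measure (Fin m → ℂ)) ∧
    ∀ z : Fin m → ℂ,
      (∃ c : ℂ, CV.HasTrace (ρ ∘L CV.displacement (√2 • z) ∘L CV.parity m ∘L σ ∘L CV.parity m ∘L
          ContinuousLinearMap.adjoint (CV.displacement (√2 • z))) c) ∧
      CV.wigner (CV.quantumConv (1 / 2) ρ σ) z
        = 2 ^ m / (Real.pi : ℂ) ^ m *
          CV.trace (ρ ∘L CV.displacement (√2 • z) ∘L CV.parity m ∘L σ ∘L CV.parity m ∘L
            ContinuousLinearMap.adjoint (CV.displacement (√2 • z))) ∧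
      (CV.wigner (CV.quantumConv (1 / 2) ρ σ) z).im = 0 ∧
      0 ≤ (CV.wigner (CV.quantumConv (1 / 2) ρ σ) z).re := by
  obtain ⟨ι, _, v, hv, hρv⟩ := hρ.exists_hasSum_rankOne
  obtain ⟨κ, _, u, hu, hσu⟩ := hσ.exists_hasSum_rankOne
  refine ⟨CV.integrable_quantumCharFun_quantumConv hv hu hρv hσu, fun z => ?_⟩
  have htr := CV.hasTrace_overlap hv hu hρv hσu (√2 • z)
  have hW := CV.wigner_quantumConv hv hu hρv hσu z
  -- `overlapSum` is by construction a real sum of squares, so reality and nonnegativity can both be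
  -- read off from this form.
  have hreal : CV.wigner (CV.quantumConv (1 / 2) ρ σ) z
      = ((2 ^ m / Real.pi ^ m * CV.overlapSum v u (√2 • z) : ℝ) : ℂ) := by
    rw [hW]; push_cast; rfl
  refine ⟨⟨_, htr⟩, by rw [htr.trace_eq, hW], by rw [hreal, Complex.ofReal_im], ?_⟩
  rw [hreal, Complex.ofReal_re]
  have : 0 ≤ CV.overlapSum v u (√2 • z) := tsum_nonneg fun _ => by positivity
  positivity
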